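/- Let $T_1,T_2,\dots$ be independent, identically distributed random variables with $T_n>0$ almost surely and $\mathbb E[T_1]<\infty$; write $T$ for a random variable with their common distribution and $\lambda=1/\mathbb E[T]$. Put $t_0=0$, $t_n=T_1+\dots+T_n$ for $n\ge1$, and for $t\ge 0$ let $N(t)=\#\{n\ge 0: t_n\le t\}$ be the associated non-delayed renewal process (the point $t_0=0$ is counted, so $N(0)=1$ almost surely) and let $R(t)=\sum_{\ell=1}^{N(t)}T_\ell-t$ be the residual time to the next renewal. Then the following three conditions are equivalent. (a) The distribution of $T$ is non-arithmetic, i.e. there is no $\delta>0$ such that $\mathbb P(T\in\{n\delta:\ n\ge1\})=1$. (b) Blackwell's renewal theorem holds: for each $h>0$, $\mathbb E[N(t+h)-N(t)]$ is finite for all $t\ge 0$ and $$\lim_{t\to\infty}\mathbb E[N(t+h)-N(t)]=\lambda h.$$ (c) $R(t)$ has a limiting distribution as $t\to\infty$, i.e. $R(t)$ converges in distribution to some probability law on $\mathbb R$. When one of these conditions holds, the limiting distribution of $R(t)$ is given by $$\lim_{t\to\infty}\mathbb P(R(t)\le x)=\lambda\int_0^x\mathbb P(T>u)\,du,\qquad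 x\ge0,$$ that is, the right-hand side is the distribution function on $[0,\infty)$ of the limit law in (c). -/

import Mathlib

open MeasureTheory ProbabilityTheory Filter Topology

noncomputable section

namespace Renewal

/-- The counting times `t_n = T_1 + ... + T_n` (so `t_0 = 0`).
The `(n+1)`-st lifetime `T_{n+1}` is `T n`. -/
def countingTime {Ω : Type*} (T : ℕ → Ω → ℝ) (n : ℕ) (ω : Ω) : ℝ :=
  ∑ i ∈ Finset.range n, T i ω

/-- The counting process `N(t)`, the number of `n ≥ 0` with `t_n ≤ t`; the point `t_0 = 0` is
counted, so `N(0) = 1`.  The set is almost surely finite for i.i.d. positive lifetimes. -/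
def count {Ω : Type*} (T : ℕ → Ω → ℝ) (t : ℝ) (ω : Ω) : ℕ :=
  {n : ℕ | countingTime T n ω ≤ t}.ncard

/-- The residual time to the next counting instant, `R(t) = T_1 + ... + T_{N(t)} - t`. -/
def residual {Ω : Type*} (T : ℕ → Ω → ℝ) (t : ℝ) (ω : Ω) : ℝ :=
  countingTime T (count T t ω) ω - t

/-- The distribution of the random variable `X` is non-arithmetic: there is no `δ > 0` such that
`P(X ∈ {n δ; n ≥ 1}) = 1`. -/
def NonArithmetic {Ω : Type*} [MeasurableSpace Ω] (X : Ω → ℝ) (μ : Measure Ω) : Prop :=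
  ¬ ∃ δ : ℝ, 0 < δ ∧ μ {ω | ∃ n : ℕ, 1 ≤ n ∧ X ω = n * δ} = 1

/-- `λ = 1 / E[T]`. -/
def rate {Ω : Type*} [MeasurableSpace Ω] (T : ℕ → Ω → ℝ) (μ : Measure Ω) : ℝ :=
  1 / ∫ ω, T 0 ω ∂μ

/-- For each `h > 0`, `E[N(t+h) - N(t)]` exists as a finite expectation for all `t ≥ 0` and tends
to `λ h` as `t → ∞`. -/
def Blackwell {Ω : Type*} [MeasurableSpace Ω] (T : ℕ → Ω → ℝ) (μ : Measure Ω) : Prop :=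
  ∀ h : ℝ, 0 < h →
    (∀ t : ℝ, 0 ≤ t → Integrable (fun ω => (count T (t + h) ω : ℝ) - (count T t ω : ℝ)) μ) ∧
    Tendsto (fun t : ℝ => ∫ ω, ((count T (t + h) ω : ℝ) - (count T t ω : ℝ)) ∂μ) atTop
      (𝓝 (rate T μ * h))

/-- `R(t)` converges in distribution, as `t → ∞`, to the probability law `ν`. -/
def ResidualTendsto {Ω : Type*} [MeasurableSpace Ω] (T : ℕ → Ω → ℝ) (μ : Measure Ω)
    [IsProbabilityMeasure μ] (ν : Measure ℝ) [IsProbabilityMeasure ν] : Prop :=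
  TendstoInDistribution (residual T) (atTop : Filter ℝ) (id : ℝ → ℝ) (fun _ => μ) ν

/-- `R(t)` has a limiting (probability) distribution as `t → ∞`. -/
def HasLimitLaw {Ω : Type*} [MeasurableSpace Ω] (T : ℕ → Ω → ℝ) (μ : Measure Ω)
    [IsProbabilityMeasure μ] : Prop :=
  ∃ (ν : Measure ℝ) (_ : IsProbabilityMeasure ν), ResidualTendsto T μ ν

/-- `λ ∫_0^x P(T > u) du`. -/
def limitCdf {Ω : Type*} [MeasurableSpace Ω] (T : ℕ → Ω → ℝ) (μ : Measure Ω) (x : ℝ) : ℝ :=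
  rate T μ * ∫ u in (0 : ℝ)..x, μ.real {ω | u < T 0 ω}

end Renewal

end

/-! Write `ρ` for the law of `T 0`, `m` for its mean, and `V = ∑ ρ^{*n}` for the renewal measure;
the expected increment of the count is the `V`-mass of a window.

The analytic core is a Choquet–Deny type argument. For a Lipschitz bump `f` of compact support, `Z =
f * V` is bounded, uniformly continuous and, beyond the support of `f`, satisfies `Z = Z * ρ`. Where
an increment `Z (t + a) - Z t` is asymptotically at its upper limit, averaging forces its backward
translates by points of the support of `ρ` to be so too. If `ρ` is non-arithmetic, sums of such
points are eventually nearly dense, so a positive upper limit would persist over arbitrarily long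
stretches and make `Z` unbounded. Hence increments of `Z` vanish at infinity
(`tendsto_sub_of_invariant`).

The value of the limit comes from the covering identity `setLIntegral_Iic_tail`: each `t ≥ 0` lies
in exactly one renewal interval. Convolving it with `f` gives `∫ ρ(u, ∞) Z(t - u) du = ∫ f` for
large `t`; since `Z` is asymptotically flat and the tail has integral `m`, `Z t → (∫ f) / m`.
Trapezoids above and below an indicator yield Blackwell's theorem. The covering identity also
expresses `P(R(t) ≤ x)` through `V` on `(t, t + x]`, so its limit follows from Blackwell and
dominated convergence.

Conversely, a law on multiples of `δ` keeps all renewals on the lattice `δℕ`, and sampling along two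
phases of that lattice contradicts both Blackwell and convergence of `R(t)`. -/

namespace Renewal

open Set
open scoped ENNReal NNReal

/-! ### Harmonic functions of a non-arithmetic law -/

/-- A submonoid of `[0, ∞)` generating a dense subgroup of `ℝ` is eventually `δ`-dense. -/
theorem exists_near_of_dense_closure (S : AddSubmonoid ℝ) (hS : ∀ x ∈ S, 0 ≤ x)
    (hd : Dense (AddSubgroup.closure (S : Set ℝ) : Set ℝ)) {δ : ℝ} (hδ : 0 < δ) :
    ∃ K : ℝ, ∀ y, K ≤ y → ∃ s ∈ S, |s - y| < δ := by
  have hdiff : ∀ x ∈ AddSubgroup.closure (S : Set ℝ), ∃ a ∈ S, ∃ b ∈ S, x = a - b := by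
    intro x hx
    induction hx using AddSubgroup.closure_induction with
    | mem x hx => exact ⟨x, hx, 0, S.zero_mem, by simp⟩
    | zero => exact ⟨0, S.zero_mem, 0, S.zero_mem, by simp⟩
    | add x y _ _ hx hy =>
      obtain ⟨a, ha, b, hb, rfl⟩ := hx
      obtain ⟨c, hc, e, he, rfl⟩ := hy
      exact ⟨a + c, S.add_mem ha hc, b + e, S.add_mem hb he, by ring⟩
    | neg x _ hx =>
      obtain ⟨a, ha, b, hb, rfl⟩ := hx
      exact ⟨b, hb, a, ha, by ring⟩
  obtain ⟨d, hdG, hd0, hdδ⟩ := hd.exists_between hδ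
  obtain ⟨a, ha, b, hb, hab⟩ := hdiff d hdG
  -- Adding `a` to both elements makes the smaller one positive, as `b` may be `0`. The sums `j • p
  -- + (m - j) • q = m * q + j * d` then fill `[m q, (m + 1) q)` with mesh `d < δ` once `m ≥ q / d`.
  obtain ⟨p, q, hp, hq, hpq, hq0⟩ : ∃ p q, p ∈ S ∧ q ∈ S ∧ p = q + d ∧ 0 < q :=
    ⟨a + a, b + a, S.add_mem ha ha, S.add_mem hb ha, by linarith, by linarith [hS b hb]⟩
  refine ⟨⌈q / d⌉₊ * q, fun y hy => ?_⟩
  have hy0 : 0 ≤ y := le_trans (by positivity) hy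
  set m := ⌊y / q⌋₊ with hm
  have hm1 : m * q ≤ y := by
    have := Nat.floor_le (div_nonneg hy0 hq0.le)
    rwa [le_div_iff₀ hq0] at this
  have hm2 : y < (m + 1) * q := by
    have := Nat.lt_floor_add_one (y / q)
    rwa [div_lt_iff₀ hq0] at this
  set j := ⌊(y - m * q) / d⌋₊ with hj
  have hj1 : j * d ≤ y - m * q := by
    have := Nat.floor_le (div_nonneg (sub_nonneg.2 hm1) hd0.le)
    rwa [le_div_iff₀ hd0] at this
  have hj2 : y - m * q < (j + 1) * d := by
    have := Nat.lt_floor_add_one ((y - m * q) / d)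
    rwa [div_lt_iff₀ hd0] at this
  have hjm : j ≤ m := by
    have h1 : ⌈q / d⌉₊ ≤ m := Nat.le_floor (by rwa [le_div_iff₀ hq0])
    have h2 : (j : ℝ) < q / d := by
      rw [lt_div_iff₀ hd0]; linarith
    have h3 : (j : ℝ) < ⌈q / d⌉₊ := h2.trans_le (Nat.le_ceil _)
    exact (Nat.cast_lt.1 h3).le.trans h1
  refine ⟨j • p + (m - j) • q, S.add_mem (S.nsmul_mem hp j) (S.nsmul_mem hq _), ?_⟩
  have : j • p + (m - j) • q = m * q + j * d := by
    simp only [nsmul_eq_mul, Nat.cast_sub hjm, hpq]; ring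
  rw [this, abs_lt]
  constructor <;> linarith

/-- The support of a non-arithmetic law on `(0, ∞)` generates a dense subgroup of `ℝ`. -/
theorem dense_closure_support {ρ : Measure ℝ} (hρ : ∀ᵐ x ∂ρ, 0 < x)
    (hna : ¬ ∃ δ : ℝ, 0 < δ ∧ ∀ᵐ x ∂ρ, ∃ n : ℕ, 1 ≤ n ∧ x = n * δ) :
    Dense (AddSubgroup.closure ρ.support : Set ℝ) := by
  refine (AddSubgroup.dense_or_cyclic _).resolve_right ?_
  rintro ⟨a, ha⟩
  have key : ∀ b : ℝ, 0 < b → AddSubgroup.closure ρ.support ≤ AddSubgroup.closure {b} → False := by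
    intro b hb hle
    refine hna ⟨b, hb, ?_⟩
    filter_upwards [hρ, Measure.support_mem_ae (μ := ρ)] with x hx hxs
    obtain ⟨n, hn⟩ := AddSubgroup.mem_closure_singleton.1 (hle (AddSubgroup.subset_closure hxs))
    rw [zsmul_eq_mul] at hn
    have hn0 : 0 < n := by
      rw [← hn] at hx
      exact_mod_cast pos_of_mul_pos_left hx hb.le
    lift n to ℕ using hn0.le
    exact ⟨n, by exact_mod_cast hn0, by simpa using hn.symm⟩
  rcases lt_trichotomy a 0 with h | h | h
  · refine key (-a) (by linarith) (ha.le.trans ?_)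
    rw [AddSubgroup.closure_le, singleton_subset_iff]
    exact AddSubgroup.mem_closure_singleton.2 ⟨-1, by simp⟩
  -- The trivial group has no positive generator, but it sits inside `ℤ`, so `1` serves as the span.
  · refine key 1 one_pos (ha.le.trans ?_)
    rw [AddSubgroup.closure_le, singleton_subset_iff, h]
    exact zero_mem _
  · exact key a h ha.le

/-- If `g` is eventually `ρ`-harmonic with upper limit at most `M`, then convergence `g t → M` along
a filter below `atTop` propagates to `g (t - x)` for `x` in the support of `ρ`. -/
theorem tendsto_sub_of_mem_support {ρ : Measure ℝ} [IsProbabilityMeasure ρ]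
    {g : ℝ → ℝ} {C M x : ℝ}
    (hg : UniformContinuous g) (hC : ∀ t, |g t| ≤ C)
    (hM : ∀ ε > 0, ∀ᶠ t in atTop, g t ≤ M + ε)
    (hinv : ∀ᶠ t in atTop, g t = ∫ y, g (t - y) ∂ρ)
    (hx : x ∈ ρ.support) {l : Filter ℝ} (hl : l ≤ atTop) (hgl : Tendsto g l (𝓝 M)) :
    Tendsto (fun t => g (t - x)) l (𝓝 M) := by
  have hgc : Continuous g := hg.continuous
  have hbd : ∀ t y, |g (t - y) - M| ≤ C + |M| := fun t y =>
    (abs_sub _ _).trans (by linarith [hC (t - y)])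
  have hint : ∀ t, Integrable (fun y => g (t - y) - M) ρ := fun t =>
    (integrable_const (C + |M|)).mono' (by fun_prop) (Eventually.of_forall (hbd t))
  have hsub : ∀ y : ℝ, Tendsto (fun t => t - y) atTop atTop := fun y =>
    tendsto_atTop_add_const_right _ (-y) tendsto_id
  have hP : Tendsto (fun t => ∫ y, max (g (t - y) - M) 0 ∂ρ) atTop (𝓝 0) := by
    have := tendsto_integral_filter_of_dominated_convergence (μ := ρ) (l := (atTop : Filter ℝ))
      (F := fun t y => max (g (t - y) - M) 0) (f := fun _ => (0 : ℝ)) (fun _ => C + |M|)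
      (Eventually.of_forall fun t => by fun_prop)
      (Eventually.of_forall fun t => Eventually.of_forall fun y => by
        rw [Real.norm_eq_abs, abs_of_nonneg (le_max_right _ _)]
        exact max_le ((le_abs_self _).trans (hbd t y)) ((abs_nonneg _).trans (hbd t y)))
      (integrable_const _)
      (Eventually.of_forall fun y => by
        rw [Metric.tendsto_nhds]
        intro ε hε
        filter_upwards [(hsub y).eventually (hM (ε / 2) (half_pos hε))] with t ht
        rw [Real.dist_eq, sub_zero, abs_of_nonneg (le_max_right _ _)]
        exact max_lt (by linarith) hε)
    simpa using this
  -- Along `l` the mean of `g (t - ·) - M` tends to `0`, and so does its positive part; hence the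
  -- negative part must vanish in mean as well.
  have hQ : Tendsto (fun t => ∫ y, max (M - g (t - y)) 0 ∂ρ) l (𝓝 0) := by
    have h1 : Tendsto (fun t => (∫ y, max (g (t - y) - M) 0 ∂ρ) - (g t - M)) l (𝓝 (0 - (M - M))) :=
      (hP.mono_left hl).sub (hgl.sub_const M)
    simp only [sub_self] at h1
    refine h1.congr' ?_
    filter_upwards [hinv.filter_mono hl] with t ht
    have h2 : g t - M = ∫ y, (g (t - y) - M) ∂ρ := by
      have h3 : Integrable (fun y => g (t - y)) ρ := by
        exact (integrable_const C).mono' (by fun_prop) (Eventually.of_forall fun y => hC _)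
      rw [integral_sub h3 (integrable_const M), ← ht]; simp
    rw [h2, ← integral_sub (hint t).pos_part (hint t)]
    refine integral_congr_ae (Eventually.of_forall fun y => ?_)
    rcases le_total (g (t - y)) M with h | h
    · simp [max_eq_right (sub_nonpos.2 h), max_eq_left (sub_nonneg.2 h)]
    · simp [max_eq_right (sub_nonpos.2 h), max_eq_left (sub_nonneg.2 h)]
  rw [Metric.tendsto_nhds]
  intro η hη
  obtain ⟨δ, hδ, hgδ⟩ := Metric.uniformContinuous_iff.1 hg (η / 2) (half_pos hη)
  have hp : 0 < ρ.real (Metric.ball x δ) :=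
    ENNReal.toReal_pos ((Measure.mem_support_iff_forall x).1 hx _ (Metric.ball_mem_nhds x hδ)).ne'
      (measure_ne_top _ _)
  filter_upwards [((hsub x).mono_left hl).eventually (hM (η / 2) (half_pos hη)),
    (hQ.eventually_lt_const (mul_pos (half_pos hη) hp))] with t ht1 ht2
  rw [Real.dist_eq, abs_lt]
  refine ⟨?_, by linarith⟩
  -- A deficit of `η` at `t - x` leaves a deficit of `η / 2` on a whole ball around `x`, which has
  -- positive mass; Markov's inequality then contradicts `hQ`.
  by_contra hcon
  refine absurd ht2 (not_lt.2 ?_)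
  have hint2 : Integrable (fun y => max (M - g (t - y)) 0) ρ := by
    have := (hint t).neg.pos_part
    simpa using this
  have h5 := mul_meas_ge_le_integral_of_nonneg (μ := ρ)
    (f := fun y => max (M - g (t - y)) 0) (Eventually.of_forall fun y => le_max_right _ _)
    hint2 (η / 2)
  refine le_trans (mul_le_mul_of_nonneg_left (measureReal_mono ?_) (half_pos hη).le) h5
  intro y hy
  rw [Metric.mem_ball, Real.dist_eq] at hy
  have := hgδ (a := t - y) (b := t - x) (by
    rw [Real.dist_eq, abs_sub_comm]; convert hy using 2; ring)
  rw [Real.dist_eq, abs_lt] at this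
  have h6 : η / 2 ≤ M - g (t - y) := by linarith [this.2, not_lt.1 hcon]
  exact h6.trans (le_max_left _ _)

/-- If the increments `g` had upper limit `M ≥ ε`, then far out there would be long runs of
consecutive steps of length `a` on which `Z` gains at least `ε / 2` each time, contradicting `|Z| ≤
C`. -/
theorem eventually_sub_le_of_invariant {ρ : Measure ℝ} [IsProbabilityMeasure ρ]
    (hρ : ∀ᵐ x ∂ρ, 0 < x)
    (hna : ¬ ∃ δ : ℝ, 0 < δ ∧ ∀ᵐ x ∂ρ, ∃ n : ℕ, 1 ≤ n ∧ x = n * δ)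
    {Z : ℝ → ℝ} {C : ℝ} (hZ : UniformContinuous Z) (hC : ∀ t, |Z t| ≤ C)
    (hinv : ∀ᶠ t in atTop, Z t = ∫ y, Z (t - y) ∂ρ) {a : ℝ} (ha : 0 < a) {ε : ℝ} (hε : 0 < ε) :
    ∀ᶠ t in atTop, Z (t + a) - Z t ≤ ε := by
  by_contra hcon
  set g : ℝ → ℝ := fun t => Z (t + a) - Z t with hgdef
  have hgu : UniformContinuous g :=
    (hZ.comp (uniformContinuous_id.add_const a)).sub hZ
  have hgC : ∀ t, |g t| ≤ C + C := fun t => (abs_sub _ _).trans (add_le_add (hC _) (hC _))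
  have hbdd : IsBoundedUnder (· ≤ ·) atTop g :=
    isBoundedUnder_of ⟨C + C, fun t => (le_abs_self _).trans (hgC t)⟩
  have hbdd' : IsBoundedUnder (· ≥ ·) atTop g :=
    isBoundedUnder_of ⟨-(C + C), fun t => (abs_le.1 (hgC t)).1⟩
  set M := limsup g atTop with hMdef
  have hMε : ε ≤ M := by
    refine le_limsup_of_frequently_le ?_ hbdd
    rw [not_eventually] at hcon
    exact hcon.mono fun t ht => (not_le.1 ht).le
  have hM : ∀ η > 0, ∀ᶠ t in atTop, g t ≤ M + η := fun η hη =>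
    (eventually_lt_of_limsup_lt (show limsup g atTop < M + η by linarith) hbdd).mono
      fun t ht => ht.le
  have hcl : MapClusterPt M atTop g := by
    rw [mapClusterPt_iff_frequently]
    intro s hs
    obtain ⟨η, hη, hηs⟩ := Metric.mem_nhds_iff.1 hs
    have h1 : ∃ᶠ t in atTop, M - η < g t :=
      frequently_lt_of_lt_limsup hbdd'.isCoboundedUnder_le (by linarith)
    refine (h1.and_eventually (hM (η / 2) (half_pos hη))).mono fun t ht => hηs ?_
    rw [Metric.mem_ball, Real.dist_eq, abs_lt]
    constructor <;> linarith [ht.1, ht.2]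
  obtain ⟨l, hl, hgl⟩ := mapClusterPt_iff_ultrafilter.1 hcl
  have hginv : ∀ᶠ t in atTop, g t = ∫ y, g (t - y) ∂ρ := by
    have hI : ∀ t, Integrable (fun y => Z (t - y)) ρ := fun t =>
      (integrable_const C).mono' (hZ.continuous.comp (by fun_prop)).aestronglyMeasurable
        (Eventually.of_forall fun y => hC _)
    filter_upwards [hinv, (tendsto_atTop_add_const_right _ a tendsto_id).eventually hinv]
      with t h1 h2
    simp only [hgdef, id] at h2 ⊢
    rw [h1, h2, ← integral_sub (hI _) (hI _)]
    simp only [sub_add_eq_add_sub]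
  -- Quantifying over all filters below `atTop`, not just the ultrafilter at hand, gives closure
  -- under addition: the filter shifted by `x` is again admissible for `y`.
  let S : AddSubmonoid ℝ :=
    { carrier := {x | 0 ≤ x ∧ ∀ l : Filter ℝ, l ≤ atTop → Tendsto g l (𝓝 M) →
        Tendsto (fun t => g (t - x)) l (𝓝 M)}
      zero_mem' := ⟨le_rfl, fun l _ h => by simpa using h⟩
      add_mem' := by
        rintro x y ⟨hx, hx'⟩ ⟨hy, hy'⟩
        refine ⟨add_nonneg hx hy, fun l hl h => ?_⟩
        have h1 := hx' l hl h
        have h2 : Tendsto (fun t => t - x) l atTop :=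
          (tendsto_atTop_add_const_right _ (-x) tendsto_id).mono_left hl
        have h3 := hy' (map (fun t => t - x) l) h2 (tendsto_map'_iff.2 h1)
        have h4 := tendsto_map'_iff.1 h3
        refine h4.congr fun t => ?_
        simp [sub_sub] }
  have hsupp : ρ.support ⊆ (S : Set ℝ) := by
    intro x hx
    refine ⟨?_, fun l hl h => tendsto_sub_of_mem_support hgu hgC hM hginv hx hl h⟩
    have : ρ.support ⊆ Ici 0 := Measure.support_subset_of_isClosed isClosed_Ici
      (hρ.mono fun x hx => hx.le)
    exact this hx
  have hdense : Dense (AddSubgroup.closure (S : Set ℝ) : Set ℝ) :=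
    (dense_closure_support hρ hna).mono (AddSubgroup.closure_mono hsupp)
  obtain ⟨δ, hδ, hgδ⟩ := Metric.uniformContinuous_iff.1 hgu (ε / 4) (by positivity)
  obtain ⟨K, hK⟩ := exists_near_of_dense_closure S (fun x hx => hx.1) hdense hδ
  have hev : ∀ y, K ≤ y → ∀ᶠ t in (l : Filter ℝ), ε / 2 ≤ g (t - y) := by
    intro y hy
    obtain ⟨s, hs, hsy⟩ := hK y hy
    have h1 := (hs.2 l hl hgl).eventually_const_lt (show M - ε / 4 < M by linarith)
    filter_upwards [h1] with t ht
    have := hgδ (a := t - y) (b := t - s) (by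
      rw [Real.dist_eq]; convert hsy using 2; ring)
    rw [Real.dist_eq, abs_lt] at this
    linarith [this.1]
  obtain ⟨n, hn⟩ := exists_nat_gt (2 * C / (ε / 2))
  have hall : ∀ᶠ t in (l : Filter ℝ), ∀ j ∈ Finset.range n, ε / 2 ≤ g (t - (K + j * a)) := by
    rw [eventually_all_finset]
    exact fun j _ => hev _ (by have : (0:ℝ) ≤ j * a := by positivity
                               linarith)
  obtain ⟨t, ht⟩ := hall.exists
  -- The steps run backwards from `t - K`, so their gains telescope to a difference of two values of
  -- `Z`, at most `2 * C`.
  have htel : ∀ m : ℕ, ∑ j ∈ Finset.range m, g (t - (K + j * a))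
      = Z (t - K + a) - Z (t - K + a - m * a) := by
    intro m
    induction m with
    | zero => simp
    | succ m ih =>
      rw [Finset.sum_range_succ, ih]
      simp only [hgdef]
      push_cast
      rw [show t - (K + m * a) + a = t - K + a - m * a by ring,
        show t - (K + m * a) = t - K + a - (m + 1) * a by ring]
      ring
  have h1 := Finset.card_nsmul_le_sum _ _ _ ht
  rw [htel, Finset.card_range, nsmul_eq_mul] at h1
  rw [div_lt_iff₀ (by positivity)] at hn
  have h2 := abs_le.1 (hC (t - K + a))
  have h3 := abs_le.1 (hC (t - K + a - n * a))
  linarith [h2.2, h3.1]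

/-- A bounded uniformly continuous function that is eventually `ρ`-harmonic for a non-arithmetic
law `ρ` on `(0, ∞)` is asymptotically constant on bounded windows. -/
theorem tendsto_sub_of_invariant {ρ : Measure ℝ} [IsProbabilityMeasure ρ]
    (hρ : ∀ᵐ x ∂ρ, 0 < x)
    (hna : ¬ ∃ δ : ℝ, 0 < δ ∧ ∀ᵐ x ∂ρ, ∃ n : ℕ, 1 ≤ n ∧ x = n * δ)
    {Z : ℝ → ℝ} {C : ℝ} (hZ : UniformContinuous Z) (hC : ∀ t, |Z t| ≤ C)
    (hinv : ∀ᶠ t in atTop, Z t = ∫ y, Z (t - y) ∂ρ) {a : ℝ} (ha : 0 < a) :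
    Tendsto (fun t => Z t - Z (t - a)) atTop (𝓝 0) := by
  have h : Tendsto (fun t => Z (t + a) - Z t) atTop (𝓝 0) := by
    rw [Metric.tendsto_nhds]
    intro ε hε
    filter_upwards [eventually_sub_le_of_invariant hρ hna hZ hC hinv ha (half_pos hε),
      eventually_sub_le_of_invariant hρ hna (Z := fun t => - Z t) hZ.neg (by simpa using hC)
        (hinv.mono fun t ht => by rw [integral_neg, ← ht]) ha (half_pos hε)] with t h1 h2
    rw [Real.dist_eq, abs_lt]
    constructor <;> linarith
  refine (h.comp (tendsto_atTop_add_const_right _ (-a) tendsto_id)).congr fun t => ?_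
  simp [← sub_eq_add_neg]

/-! ### The renewal measure and the covering identity -/

/-- The `n`-fold convolution power of a law on `ℝ`. -/
noncomputable def convPow (ρ : Measure ℝ) : ℕ → Measure ℝ
  | 0 => Measure.dirac 0
  | n + 1 => (convPow ρ n).conv ρ

instance convPow.isProbabilityMeasure (ρ : Measure ℝ) [IsProbabilityMeasure ρ] (n : ℕ) :
    IsProbabilityMeasure (convPow ρ n) := by
  induction n with
  | zero => simp only [convPow]; infer_instance
  | succ n ih => simp only [convPow]; infer_instance

/-- The renewal measure `∑ ρ^{*n}`. -/
noncomputable def renewalMeasure (ρ : Measure ℝ) : Measure ℝ := Measure.sum (convPow ρ)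

instance renewalMeasure.sFinite (ρ : Measure ℝ) [IsProbabilityMeasure ρ] :
    SFinite (renewalMeasure ρ) := by
  unfold renewalMeasure; infer_instance

theorem measurable_Ioi_sub (ρ : Measure ℝ) (t : ℝ) : Measurable fun s => ρ (Ioi (t - s)) := by
  have : Monotone fun s => ρ (Ioi (t - s)) := fun a b hab =>
    measure_mono (Ioi_subset_Ioi (by linarith))
  exact this.measurable

theorem measurable_Iic_sub (ρ : Measure ℝ) (t : ℝ) : Measurable fun s => ρ (Iic (t - s)) := by
  have : Antitone fun s => ρ (Iic (t - s)) := fun a b hab =>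
    measure_mono (Iic_subset_Iic.2 (by linarith))
  exact this.measurable

section

variable {ρ : Measure ℝ} [IsProbabilityMeasure ρ]

/-- The renewal equation `V = δ₀ + V * ρ`: split off the zeroth term of the series. -/
theorem lintegral_renewalMeasure_eq {g : ℝ → ℝ≥0∞} (hg : Measurable g) :
    ∫⁻ s, g s ∂(renewalMeasure ρ) = g 0 + ∫⁻ s, ∫⁻ y, g (s + y) ∂ρ ∂(renewalMeasure ρ) := by
  rw [renewalMeasure, lintegral_sum_measure, lintegral_sum_measure,
    tsum_eq_zero_add' ENNReal.summable]
  simp only [convPow, lintegral_dirac' _ hg, Measure.lintegral_conv hg]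

/-- The Laplace transform of `V` at `1` is a geometric series in `q = ∫ exp(-y) dρ`, and positivity
gives `q < 1`. Bounding `exp(-s)` below on the half-line finishes. -/
theorem renewalMeasure_Iic_lt_top (hρ : ∀ᵐ x ∂ρ, 0 < x) (t : ℝ) :
    renewalMeasure ρ (Iic t) < ∞ := by
  set e : ℝ → ℝ≥0∞ := fun s => ENNReal.ofReal (Real.exp (-s)) with he
  have hem : Measurable e := by fun_prop
  set q := ∫⁻ y, e y ∂ρ with hq
  have hq1 : q < 1 := by
    have := lintegral_strict_mono (μ := ρ) (f := e) (g := fun _ => 1)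
      (IsProbabilityMeasure.ne_zero ρ)
      aemeasurable_const (by
        refine ne_top_of_le_ne_top (b := 1) ENNReal.one_ne_top ?_
        refine (lintegral_mono_ae (g := fun _ => 1) (hρ.mono fun x hx => ?_)).trans (by simp)
        simp [he, hx.le])
      (hρ.mono fun x hx => by simp [he, ENNReal.ofReal_lt_one, hx])
    simpa using this
  have hpow : ∀ n, ∫⁻ s, e s ∂(convPow ρ n) = q ^ n := by
    intro n
    induction n with
    | zero => simp [convPow, he]
    | succ n ih =>
      rw [convPow, Measure.lintegral_conv hem, pow_succ, ← ih, ← lintegral_mul_const _ hem]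
      refine lintegral_congr fun x => ?_
      rw [hq, ← lintegral_const_mul _ hem]
      refine lintegral_congr fun y => ?_
      simp only [he]
      rw [← ENNReal.ofReal_mul (Real.exp_nonneg _), ← Real.exp_add, neg_add]
  have hsum : ∫⁻ s, e s ∂(renewalMeasure ρ) < ∞ := by
    rw [renewalMeasure, lintegral_sum_measure]
    simp only [hpow]
    rw [ENNReal.tsum_geometric, ENNReal.inv_lt_top]
    exact tsub_pos_of_lt hq1
  have hle : e t * renewalMeasure ρ (Iic t) ≤ ∫⁻ s, e s ∂(renewalMeasure ρ) := by
    rw [← setLIntegral_const]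
    refine (setLIntegral_mono hem fun s hs => ?_).trans (setLIntegral_le_lintegral _ _)
    exact ENNReal.ofReal_le_ofReal (Real.exp_le_exp.2 (neg_le_neg hs))
  have het : e t ≠ 0 := by simp [he, Real.exp_pos]
  by_contra hcon
  rw [not_lt, top_le_iff] at hcon
  rw [hcon, ENNReal.mul_top het] at hle
  exact absurd hsum (not_lt.2 hle)

/-- Exactly one renewal interval covers each `t ≥ 0`. -/
theorem setLIntegral_Iic_tail (hρ : ∀ᵐ x ∂ρ, 0 < x) (t : ℝ) :
    ∫⁻ s in Iic t, ρ (Ioi (t - s)) ∂(renewalMeasure ρ) = (Ici (0 : ℝ)).indicator 1 t := by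
  have h1 := lintegral_renewalMeasure_eq (ρ := ρ) (g := (Iic t).indicator 1)
    (measurable_one.indicator measurableSet_Iic)
  rw [lintegral_indicator_one measurableSet_Iic] at h1
  have h2 : ∀ s, ∫⁻ y, (Iic t).indicator (1 : ℝ → ℝ≥0∞) (s + y) ∂ρ = ρ (Iic (t - s)) := by
    intro s
    rw [← lintegral_indicator_one measurableSet_Iic]
    refine lintegral_congr fun y => ?_
    simp only [indicator, mem_Iic, Pi.one_apply, le_sub_iff_add_le, add_comm s y]
  simp only [h2] at h1
  have h3 : renewalMeasure ρ (Iic t) = ∫⁻ s, ρ (Iic (t - s)) ∂(renewalMeasure ρ)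
      + ∫⁻ s in Iic t, ρ (Ioi (t - s)) ∂(renewalMeasure ρ) := by
    rw [← lintegral_indicator measurableSet_Iic, ← lintegral_add_left (measurable_Iic_sub ρ t),
      ← lintegral_indicator_one measurableSet_Iic]
    refine lintegral_congr fun s => ?_
    by_cases hs : s ∈ Iic t
    · rw [indicator_of_mem hs, indicator_of_mem hs, Pi.one_apply, ← compl_Iic,
        prob_add_prob_compl measurableSet_Iic]
    · rw [indicator_of_notMem hs, indicator_of_notMem hs, add_zero, eq_comm]
      refine measure_mono_null ?_ (show ρ {x | ¬ 0 < x} = 0 from hρ)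
      intro x hx
      simp only [mem_Iic, mem_ofPred_eq, not_lt] at *
      linarith
  have hfin := (renewalMeasure_Iic_lt_top hρ t).ne
  have h4 : (Iic t).indicator (1 : ℝ → ℝ≥0∞) 0 = (Ici (0 : ℝ)).indicator 1 t := by
    simp [indicator]
  rw [h4, add_comm] at h1
  -- Finiteness is what permits cancelling this common term in `ℝ≥0∞`.
  have h5 : ∫⁻ s, ρ (Iic (t - s)) ∂(renewalMeasure ρ) ≠ ∞ :=
    ne_top_of_le_ne_top hfin (by rw [h3]; exact le_self_add)
  rw [h1] at h3
  exact ((ENNReal.add_right_inj h5).1 h3).symm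

/-- Choose `h` with `p = ρ (h, ∞) > 0`. A renewal in `(t, t + h]` has chance at least `p` of
starting the interval covering `t + h`, so the covering identity bounds the mass of a window of
length `h` by `1 / p`; longer windows are chained. -/
theorem exists_renewalMeasure_Ioc_le (hρ : ∀ᵐ x ∂ρ, 0 < x) (L : ℝ) :
    ∃ C : ℝ≥0, ∀ t, renewalMeasure ρ (Ioc t (t + L)) ≤ C := by
  obtain ⟨h, hh, hp⟩ : ∃ h : ℝ, 0 < h ∧ ρ (Ioi h) ≠ 0 := by
    by_contra! hcon
    have h0 : ρ (⋃ n : ℕ, Ioi (1 / ((n : ℝ) + 1))) = 0 :=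
      measure_iUnion_null fun n => hcon _ (by positivity)
    have h1 : ∀ᵐ x ∂ρ, x ∈ ⋃ n : ℕ, Ioi (1 / ((n : ℝ) + 1)) := by
      filter_upwards [hρ] with x hx
      obtain ⟨n, hn⟩ := exists_nat_one_div_lt hx
      exact mem_iUnion.2 ⟨n, hn⟩
    have h2 := (prob_compl_eq_zero_iff (MeasurableSet.iUnion fun _ => measurableSet_Ioi)).1
      (show ρ (⋃ n : ℕ, Ioi (1 / ((n : ℝ) + 1)))ᶜ = 0 from h1)
    exact zero_ne_one (h0.symm.trans h2)
  set p := ρ (Ioi h)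
  have hshort : ∀ t, renewalMeasure ρ (Ioc t (t + h)) ≤ p⁻¹ := by
    intro t
    rw [ENNReal.le_inv_iff_mul_le, mul_comm, ← setLIntegral_const]
    calc ∫⁻ _ in Ioc t (t + h), p ∂(renewalMeasure ρ)
        ≤ ∫⁻ s in Ioc t (t + h), ρ (Ioi (t + h - s)) ∂(renewalMeasure ρ) :=
          setLIntegral_mono (measurable_Ioi_sub ρ _) fun s hs =>
            measure_mono (Ioi_subset_Ioi (by linarith [hs.1]))
      _ ≤ ∫⁻ s in Iic (t + h), ρ (Ioi (t + h - s)) ∂(renewalMeasure ρ) :=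
          lintegral_mono_set fun s hs => hs.2
      _ ≤ 1 := by
          rw [setLIntegral_Iic_tail hρ]
          exact indicator_le_self' (by simp) _
  have hlong : ∀ (n : ℕ) t, renewalMeasure ρ (Ioc t (t + n * h)) ≤ n * p⁻¹ := by
    intro n
    induction n with
    | zero => simp
    | succ n ih =>
      intro t
      rw [show t + ((n + 1 : ℕ) : ℝ) * h = t + n * h + h by push_cast; ring,
        ← Ioc_union_Ioc_eq_Ioc (b := t + n * h) (by
          have : 0 ≤ n * h := by positivity
          linarith) (by linarith)]
      refine (measure_union_le _ _).trans ?_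
      rw [Nat.cast_succ, add_mul, one_mul]
      exact add_le_add (ih t) (hshort _)
  obtain ⟨n, hn⟩ := exists_nat_ge (L / h)
  refine ⟨(n * p⁻¹).toNNReal, fun t => ?_⟩
  rw [ENNReal.coe_toNNReal (ENNReal.mul_ne_top (by simp) (ENNReal.inv_ne_top.2 hp))]
  refine (measure_mono (Ioc_subset_Ioc_right ?_)).trans (hlong n t)
  rw [div_le_iff₀ hh] at hn
  linarith

end

/-! ### Renewal limits for Lipschitz test functions -/

/-- The tail `ρ (u, ∞)` of a law on the half-line `u ≥ 0`, extended by `0`. -/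
noncomputable def tail (ρ : Measure ℝ) (u : ℝ) : ℝ≥0∞ :=
  (Ici (0 : ℝ)).indicator (fun u => ρ (Ioi u)) u

theorem measurable_tail (ρ : Measure ℝ) : Measurable (tail ρ) := by
  have : Antitone fun u => ρ (Ioi u) := fun a b hab => measure_mono (Ioi_subset_Ioi hab)
  exact this.measurable.indicator measurableSet_Ici

theorem lintegral_tail {ρ : Measure ℝ} (hρ : ∀ᵐ x ∂ρ, 0 < x) (hint : Integrable id ρ) :
    ∫⁻ u, tail ρ u = ENNReal.ofReal (∫ x, x ∂ρ) := by
  have h0 : 0 ≤ᵐ[ρ] fun x : ℝ => x := hρ.mono fun x hx => hx.le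
  rw [ofReal_integral_eq_lintegral_ofReal (f := fun x => x) hint h0,
    lintegral_eq_lintegral_meas_lt _ h0 aemeasurable_id, setLIntegral_congr Ioi_ae_eq_Ici]
  exact lintegral_indicator measurableSet_Ici _

theorem integrable_tail {ρ : Measure ℝ} (hρ : ∀ᵐ x ∂ρ, 0 < x) (hint : Integrable id ρ) :
    Integrable fun u => (tail ρ u).toReal :=
  integrable_toReal_of_lintegral_ne_top (measurable_tail ρ).aemeasurable
    (by rw [lintegral_tail hρ hint]; finiteness)

section

variable {ρ : Measure ℝ} [IsProbabilityMeasure ρ]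

/-- The covering identity says that the convolution of the tail with `V` is the indicator of `[0,
∞)`; this is its form against a test function, obtained by Tonelli. -/
theorem lintegral_tail_mul (hρ : ∀ᵐ x ∂ρ, 0 < x) {F : ℝ → ℝ≥0∞} (hF : Measurable F) (t : ℝ) :
    ∫⁻ u, tail ρ u * ∫⁻ s, F (t - u - s) ∂(renewalMeasure ρ) = ∫⁻ v in Ici 0, F (t - v) := by
  have hG := measurable_tail ρ
  calc ∫⁻ u, tail ρ u * ∫⁻ s, F (t - u - s) ∂(renewalMeasure ρ)
      = ∫⁻ u, ∫⁻ s, tail ρ u * F (t - u - s) ∂(renewalMeasure ρ) := by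
        refine lintegral_congr fun u => ?_
        rw [lintegral_const_mul _ (by fun_prop)]
    _ = ∫⁻ s, (∫⁻ u, tail ρ u * F (t - u - s)) ∂(renewalMeasure ρ) :=
        lintegral_lintegral_swap (by fun_prop)
    _ = ∫⁻ s, (∫⁻ v, tail ρ (v - s) * F (t - v)) ∂(renewalMeasure ρ) := by
        refine lintegral_congr fun s => ?_
        rw [← lintegral_sub_right_eq_self (μ := volume) (fun u => tail ρ u * F (t - u - s)) s]
        refine lintegral_congr fun v => ?_
        rw [show t - (v - s) - s = t - v by ring]
    _ = ∫⁻ v, ∫⁻ s, tail ρ (v - s) * F (t - v) ∂(renewalMeasure ρ) :=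
        lintegral_lintegral_swap (by fun_prop)
    _ = ∫⁻ v, (Ici (0 : ℝ)).indicator (fun v => F (t - v)) v := by
        refine lintegral_congr fun v => ?_
        rw [lintegral_mul_const _ (by fun_prop)]
        have h1 : ∫⁻ s, tail ρ (v - s) ∂(renewalMeasure ρ) = (Ici (0 : ℝ)).indicator 1 v := by
          rw [← setLIntegral_Iic_tail hρ, ← lintegral_indicator measurableSet_Iic]
          refine lintegral_congr fun s => ?_
          simp [tail, indicator]
        rw [h1]
        by_cases hv : v ∈ Ici (0 : ℝ)
        · rw [indicator_of_mem hv, indicator_of_mem hv, Pi.one_apply, one_mul]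
        · rw [indicator_of_notMem hv, indicator_of_notMem hv, zero_mul]
    _ = ∫⁻ v in Ici 0, F (t - v) := lintegral_indicator measurableSet_Ici _

theorem tail_ne_top (u : ℝ) : tail ρ u ≠ ∞ := by
  unfold tail indicator
  split_ifs <;> finiteness

theorem mean_pos (hρ : ∀ᵐ x ∂ρ, 0 < x) (hint : Integrable id ρ) : 0 < ∫ x, x ∂ρ := by
  rw [integral_pos_iff_support_of_nonneg_ae (hρ.mono fun x hx => hx.le) hint]
  have : ρ (Function.support fun x : ℝ => x) = 1 := by
    rw [← measure_univ (μ := ρ)]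
    exact measure_congr (eventuallyEq_univ.2 (hρ.mono fun x hx => hx.ne'))
  rw [this]; exact one_pos

theorem integral_tail (hρ : ∀ᵐ x ∂ρ, 0 < x) (hint : Integrable id ρ) :
    ∫ u, (tail ρ u).toReal = ∫ x, x ∂ρ := by
  rw [integral_toReal (measurable_tail ρ).aemeasurable
    (Eventually.of_forall fun u => (tail_ne_top u).lt_top), lintegral_tail hρ hint,
    ENNReal.toReal_ofReal (mean_pos hρ hint).le]

/-- Asymptotic flatness lets `Z (t - u)` be replaced by `Z t` in the identity `∫ tail(u) Z(t - u) du
= ∫ f`. Finite mean supplies the integrable majorant. -/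
theorem tendsto_integral_sub_renewalMeasure (hρ : ∀ᵐ x ∂ρ, 0 < x)
    (hna : ¬ ∃ δ : ℝ, 0 < δ ∧ ∀ᵐ x ∂ρ, ∃ n : ℕ, 1 ≤ n ∧ x = n * δ) (hint : Integrable id ρ)
    {f : ℝ → ℝ} (hf0 : ∀ u, 0 ≤ f u) (hf1 : ∀ u, f u ≤ 1) {R : ℝ} (hR : ∀ u, R ≤ |u| → f u = 0)
    {K : ℝ≥0} (hK : LipschitzWith K f) :
    (∀ t, Integrable (fun s => f (t - s)) (renewalMeasure ρ)) ∧
    Tendsto (fun t => ∫ s, f (t - s) ∂(renewalMeasure ρ)) atTop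
      (𝓝 ((∫ x, x ∂ρ)⁻¹ * ∫ u, f u)) := by
  have hfc : Continuous f := hK.continuous
  set V := renewalMeasure ρ with hV
  obtain ⟨C, hC⟩ := exists_renewalMeasure_Ioc_le hρ (2 * R)
  obtain ⟨D, hD⟩ := exists_renewalMeasure_Ioc_le hρ (2 * R + 2)
  have hind : ∀ t s, f (t - s) ≤ (Ioc (t - R) (t - R + 2 * R)).indicator 1 s := by
    intro t s
    by_cases hs : s ∈ Ioc (t - R) (t - R + 2 * R)
    · rw [indicator_of_mem hs]; exact hf1 _
    · rw [indicator_of_notMem hs, hR]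
      by_contra! hcon
      rw [abs_lt] at hcon
      exact hs ⟨by linarith [hcon.2], by linarith [hcon.1]⟩
  have hVfin : ∀ t, V (Ioc (t - R) (t - R + 2 * R)) < ∞ := fun t =>
    (hC _).trans_lt ENNReal.coe_lt_top
  have hindint : ∀ t, Integrable ((Ioc (t - R) (t - R + 2 * R)).indicator (1 : ℝ → ℝ)) V :=
    fun t => (integrable_indicator_iff measurableSet_Ioc).2 (integrableOn_const (hVfin t).ne)
  have hfi : ∀ t, Integrable (fun s => f (t - s)) V := fun t =>
    (hindint t).mono' (by fun_prop) (Eventually.of_forall fun s => by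
      rw [Real.norm_eq_abs, abs_of_nonneg (hf0 _)]; exact hind t s)
  refine ⟨hfi, ?_⟩
  set Z : ℝ → ℝ := fun t => ∫ s, f (t - s) ∂V with hZ
  have hZ0 : ∀ t, 0 ≤ Z t := fun t => integral_nonneg fun s => hf0 _
  have hZC : ∀ t, |Z t| ≤ C := by
    intro t
    rw [abs_of_nonneg (hZ0 t)]
    refine (integral_mono (hfi t) (hindint t) (hind t)).trans ?_
    rw [integral_indicator_one measurableSet_Ioc]
    exact ENNReal.toReal_le_coe_of_le_coe (hC _)
  have hZu : UniformContinuous Z := by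
    rw [Metric.uniformContinuous_iff]
    intro ε hε
    -- Keeping `|a - b| < 1` puts both translated supports in one window of length `2 * R + 2`, of
    -- mass at most `D`; the `+ 1` avoids division by zero.
    refine ⟨min 1 (ε / (K * D + 1)), lt_min one_pos (by positivity), fun {a b} hab => ?_⟩
    rw [lt_min_iff, Real.dist_eq] at hab
    obtain ⟨hab1, hab2⟩ := hab
    rw [lt_div_iff₀ (by positivity)] at hab2
    set I := Ioc (a - R - 1) (a - R - 1 + (2 * R + 2))
    have hI : Integrable (I.indicator fun _ => (K * |a - b| : ℝ)) V :=
      (integrable_indicator_iff measurableSet_Ioc).2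
        (integrableOn_const ((hD _).trans_lt ENNReal.coe_lt_top).ne)
    rw [hZ, Real.dist_eq, ← integral_sub (hfi a) (hfi b), ← Real.norm_eq_abs]
    have h1 := norm_integral_le_of_norm_le (f := fun s => f (a - s) - f (b - s)) hI
      (Eventually.of_forall fun s => by
        by_cases hs : s ∈ I
        · rw [indicator_of_mem hs]
          have := hK.dist_le_mul (a - s) (b - s)
          rw [Real.dist_eq, Real.dist_eq] at this
          rw [Real.norm_eq_abs]
          convert this using 3
          ring
        · rw [indicator_of_notMem hs, hR, hR, sub_zero, norm_zero]
          all_goals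
            rw [abs_lt] at hab1
            by_contra! hcon
            rw [abs_lt] at hcon
            exact hs ⟨by linarith [hcon.2], by linarith [hcon.1]⟩)
    rw [integral_indicator measurableSet_Ioc, setIntegral_const, smul_eq_mul] at h1
    have h2 : V.real I ≤ D := ENNReal.toReal_le_coe_of_le_coe (hD _)
    have h3 : V.real I * (K * |a - b|) ≤ D * (K * |a - b|) := by gcongr
    nlinarith [abs_nonneg (a - b)]
  have hZl : ∀ t, ∫⁻ s, ENNReal.ofReal (f (t - s)) ∂V = ENNReal.ofReal (Z t) := fun t =>
    (ofReal_integral_eq_lintegral_ofReal (hfi t) (Eventually.of_forall fun s => hf0 _)).symm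
  have hinv : ∀ᶠ t in atTop, Z t = ∫ y, Z (t - y) ∂ρ := by
    filter_upwards [eventually_ge_atTop R] with t ht
    have h1 := lintegral_renewalMeasure_eq (ρ := ρ) (g := fun s => ENNReal.ofReal (f (t - s)))
      (by fun_prop)
    rw [← hV, hZl, sub_zero, hR t (ht.trans (le_abs_self t)), ENNReal.ofReal_zero, zero_add,
      lintegral_lintegral_swap (by fun_prop)] at h1
    have h2 : ∀ y, ∫⁻ s, ENNReal.ofReal (f (t - (s + y))) ∂V = ENNReal.ofReal (Z (t - y)) := by
      intro y
      rw [← hZl]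
      refine lintegral_congr fun s => ?_
      rw [sub_sub, add_comm]
    simp only [h2] at h1
    rw [integral_eq_lintegral_of_nonneg_ae (Eventually.of_forall fun y => hZ0 _)
      (hZu.continuous.comp (by fun_prop)).aestronglyMeasurable, ← h1,
      ENNReal.toReal_ofReal (hZ0 t)]
  have hZc : Continuous Z := hZu.continuous
  have hm := mean_pos hρ hint
  have hslow : ∀ a, 0 ≤ a → Tendsto (fun t => Z t - Z (t - a)) atTop (𝓝 0) := by
    intro a ha
    rcases ha.eq_or_lt with rfl | ha
    · simp
    · exact tendsto_sub_of_invariant hρ hna hZu hZC hinv ha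
  have hTi := integrable_tail hρ hint
  have hTm : Measurable fun u => (tail ρ u).toReal := (measurable_tail ρ).ennreal_toReal
  have hTZ : ∀ t, Integrable fun u => (tail ρ u).toReal * Z (t - u) := fun t => by
    refine (hTi.mul_const (C : ℝ)).mono' (hTm.aestronglyMeasurable.mul (by fun_prop)) (Eventually.of_forall fun u => ?_)
    rw [norm_mul, Real.norm_eq_abs, Real.norm_eq_abs, abs_of_nonneg ENNReal.toReal_nonneg]
    exact mul_le_mul_of_nonneg_left (hZC _) ENNReal.toReal_nonneg
  have hident : ∀ᶠ t in atTop, ∫ u, (tail ρ u).toReal * Z (t - u) = ∫ u, f u := by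
    filter_upwards [eventually_ge_atTop R] with t ht
    have h1 := lintegral_tail_mul hρ (F := fun u => ENNReal.ofReal (f u)) (by fun_prop) t
    simp only [← hV, hZl] at h1
    have h2 : ∫⁻ v in Ici 0, ENNReal.ofReal (f (t - v)) = ∫⁻ u, ENNReal.ofReal (f u) := by
      rw [← lintegral_sub_left_eq_self (μ := volume) (fun u => ENNReal.ofReal (f u)) t,
        ← lintegral_indicator measurableSet_Ici]
      refine lintegral_congr fun v => ?_
      by_cases hv : v ∈ Ici (0 : ℝ)
      · rw [indicator_of_mem hv]
      · rw [indicator_of_notMem hv, hR, ENNReal.ofReal_zero]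
        rw [mem_Ici, not_le] at hv
        exact le_abs.2 (Or.inl (by linarith))
    rw [h2] at h1
    rw [integral_eq_lintegral_of_nonneg_ae (f := f) (Eventually.of_forall hf0)
      hfc.aestronglyMeasurable, ← h1, integral_eq_lintegral_of_nonneg_ae
      (Eventually.of_forall fun u => mul_nonneg ENNReal.toReal_nonneg (hZ0 _))
      (hTZ t).aestronglyMeasurable]
    congr 1
    refine lintegral_congr fun u => ?_
    rw [ENNReal.ofReal_mul ENNReal.toReal_nonneg, ENNReal.ofReal_toReal (tail_ne_top u)]
  have hlim : Tendsto (fun t => ∫ u, (tail ρ u).toReal * (Z t - Z (t - u))) atTop (𝓝 0) := by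
    have := tendsto_integral_filter_of_dominated_convergence (l := (atTop : Filter ℝ))
      (F := fun t u => (tail ρ u).toReal * (Z t - Z (t - u))) (f := fun _ => (0 : ℝ))
      (fun u => (tail ρ u).toReal * (C + C : ℝ))
      (Eventually.of_forall fun t => hTm.aestronglyMeasurable.mul (by fun_prop))
      (Eventually.of_forall fun t => Eventually.of_forall fun u => by
        rw [norm_mul, Real.norm_eq_abs, Real.norm_eq_abs, abs_of_nonneg ENNReal.toReal_nonneg]
        exact mul_le_mul_of_nonneg_left ((abs_sub _ _).trans (add_le_add (hZC _) (hZC _)))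
          ENNReal.toReal_nonneg)
      (hTi.mul_const _)
      (Eventually.of_forall fun u => by
        rcases le_or_gt 0 u with hu | hu
        · simpa using (hslow u hu).const_mul (tail ρ u).toReal
        · have : tail ρ u = 0 := indicator_of_notMem (by simpa using hu) _
          simp [this])
    simpa using this
  have hlim2 : Tendsto (fun t => (∫ x, x ∂ρ) * Z t) atTop (𝓝 (∫ u, f u)) := by
    rw [← zero_add (∫ u, f u)]
    refine (hlim.add_const (∫ u, f u)).congr' ?_
    filter_upwards [hident] with t ht
    simp only [mul_sub]
    rw [integral_sub (hTi.mul_const _) (hTZ t), ht, integral_mul_const, integral_tail hρ hint]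
    ring
  refine (hlim2.const_mul (∫ x, x ∂ρ)⁻¹).congr fun t => ?_
  rw [inv_mul_cancel_left₀ hm.ne']

end

/-! ### From test functions to windows and the residual integral -/

/-- The trapezoid equal to `1` on `[-r, r]` and to `0` outside `(-r - ε, r + ε)`. -/
noncomputable def trapezoid (r ε u : ℝ) : ℝ := max 0 (min 1 ((r + ε - |u|) / ε))

theorem trapezoid_nonneg (r ε u : ℝ) : 0 ≤ trapezoid r ε u := le_max_left _ _

theorem trapezoid_le_one (r ε u : ℝ) : trapezoid r ε u ≤ 1 := max_le zero_le_one (min_le_left _ _)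

theorem trapezoid_eq_zero {r ε u : ℝ} (hε : 0 < ε) (hu : r + ε ≤ |u|) : trapezoid r ε u = 0 :=
  max_eq_left ((min_le_right _ _).trans (div_nonpos_of_nonpos_of_nonneg (by linarith) hε.le))

theorem trapezoid_eq_one {r ε u : ℝ} (hε : 0 < ε) (hu : |u| ≤ r) : trapezoid r ε u = 1 := by
  have : 1 ≤ (r + ε - |u|) / ε := by rw [le_div_iff₀ hε]; linarith
  rw [trapezoid, min_eq_left this, max_eq_right zero_le_one]

theorem lipschitzWith_trapezoid (r : ℝ) {ε : ℝ} (hε : 0 < ε) :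
    LipschitzWith (Real.toNNReal ε⁻¹) (trapezoid r ε) := by
  refine (LipschitzWith.const_min ?_ 1).const_max 0
  refine LipschitzWith.of_dist_le_mul fun a b => ?_
  rw [Real.coe_toNNReal _ (by positivity), Real.dist_eq, Real.dist_eq, ← sub_div, abs_div,
    abs_of_pos hε, div_eq_inv_mul]
  refine mul_le_mul_of_nonneg_left ?_ (by positivity)
  rw [show r + ε - |a| - (r + ε - |b|) = |b| - |a| by ring, abs_sub_comm a b]
  exact abs_abs_sub_abs_le _ _

theorem trapezoid_le_indicator {r ε : ℝ} (hε : 0 < ε) (u : ℝ) :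
    trapezoid r ε u ≤ (Icc (-(r + ε)) (r + ε)).indicator 1 u := by
  by_cases hu : u ∈ Icc (-(r + ε)) (r + ε)
  · rw [indicator_of_mem hu]; exact trapezoid_le_one _ _ _
  · rw [indicator_of_notMem hu, trapezoid_eq_zero hε]
    by_contra! hcon
    exact hu (abs_le.1 hcon.le)

theorem integral_trapezoid_mem {r ε : ℝ} (hr : 0 ≤ r) (hε : 0 < ε) :
    ∫ u, trapezoid r ε u ∈ Icc (2 * r) (2 * (r + ε)) := by
  have hi : ∀ a : ℝ, Integrable ((Icc (-a) a).indicator (1 : ℝ → ℝ)) := fun a =>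
    (integrable_indicator_iff measurableSet_Icc).2 (integrableOn_const (by simp))
  have hv : ∀ a : ℝ, 0 ≤ a → ∫ u, (Icc (-a) a).indicator (1 : ℝ → ℝ) u = 2 * a := fun a ha => by
    rw [integral_indicator_one measurableSet_Icc, Real.volume_real_Icc_of_le (by linarith)]; ring
  have ht : Integrable (trapezoid r ε) := (hi (r + ε)).mono'
    (lipschitzWith_trapezoid r hε).continuous.aestronglyMeasurable
    (Eventually.of_forall fun u => by
      rw [Real.norm_eq_abs, abs_of_nonneg (trapezoid_nonneg _ _ _)]
      exact trapezoid_le_indicator hε u)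
  constructor
  · rw [← hv r hr]
    refine integral_mono (hi r) ht fun u => ?_
    by_cases hu : u ∈ Icc (-r) r
    · rw [indicator_of_mem hu, trapezoid_eq_one hε (abs_le.2 hu)]; rfl
    · rw [indicator_of_notMem hu]; exact trapezoid_nonneg _ _ _
  · rw [← hv (r + ε) (by positivity)]
    exact integral_mono ht (hi _) (trapezoid_le_indicator hε)

section

variable {ρ : Measure ℝ} [IsProbabilityMeasure ρ]

/-- Blackwell's theorem for the renewal measure of a non-arithmetic law. -/
theorem tendsto_renewalMeasure_Ioc (hρ : ∀ᵐ x ∂ρ, 0 < x)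
    (hna : ¬ ∃ δ : ℝ, 0 < δ ∧ ∀ᵐ x ∂ρ, ∃ n : ℕ, 1 ≤ n ∧ x = n * δ) (hint : Integrable id ρ)
    {h : ℝ} (hh : 0 < h) :
    Tendsto (fun t => (renewalMeasure ρ).real (Ioc t (t + h))) atTop (𝓝 ((∫ x, x ∂ρ)⁻¹ * h)) := by
  have hm := mean_pos hρ hint
  set lam := (∫ x, x ∂ρ)⁻¹ with hlam
  have hlam0 : 0 < lam := inv_pos.2 hm
  obtain ⟨C, hC⟩ := exists_renewalMeasure_Ioc_le hρ h
  have hI : ∀ t, Integrable ((Ioc t (t + h)).indicator (1 : ℝ → ℝ)) (renewalMeasure ρ) := fun t =>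
    (integrable_indicator_iff measurableSet_Ioc).2
      (integrableOn_const ((hC t).trans_lt ENNReal.coe_lt_top).ne)
  -- Trapezoids are centred, so they are evaluated at the midpoint `t + h / 2` of the window.
  have hshift : Tendsto (fun t : ℝ => t + h / 2) atTop atTop :=
    tendsto_atTop_add_const_right _ _ tendsto_id
  have key := fun r {ε : ℝ} (hε : 0 < ε) =>
    tendsto_integral_sub_renewalMeasure hρ hna hint (f := trapezoid r ε) (trapezoid_nonneg r ε)
      (trapezoid_le_one r ε) (R := r + ε) (fun u hu => trapezoid_eq_zero hε hu)
      (lipschitzWith_trapezoid r hε)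
  rw [tendsto_order]
  constructor
  · intro a ha
    obtain ⟨ε, hε, hε2, hεa⟩ : ∃ ε : ℝ, 0 < ε ∧ ε ≤ h / 2 ∧ a < lam * (h - 2 * ε) := by
      refine ⟨min (h / 2) ((lam * h - a) / (4 * lam)), lt_min (by positivity)
        (div_pos (by linarith) (by positivity)), min_le_left _ _, ?_⟩
      have := min_le_right (h / 2) ((lam * h - a) / (4 * lam))
      rw [le_div_iff₀ (by positivity)] at this
      nlinarith
    obtain ⟨k1, k2⟩ := key (h / 2 - ε) hε
    have hb := (integral_trapezoid_mem (r := h / 2 - ε) (by linarith) hε).1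
    have hlt : a < lam * ∫ u, trapezoid (h / 2 - ε) ε u :=
      hεa.trans_le (mul_le_mul_of_nonneg_left (by linarith) hlam0.le)
    filter_upwards [(k2.comp hshift).eventually_const_lt hlt] with t ht
    refine ht.trans_le ?_
    rw [← integral_indicator_one measurableSet_Ioc]
    refine integral_mono (k1 _) (hI t) fun s => ?_
    by_cases hs : s ∈ Ioc t (t + h)
    · rw [indicator_of_mem hs]; exact trapezoid_le_one _ _ _
    · rw [indicator_of_notMem hs]
      refine (trapezoid_eq_zero hε ?_).le
      by_contra! hcon
      rw [abs_lt] at hcon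
      exact hs ⟨by linarith [hcon.2], by linarith [hcon.1]⟩
  · intro a ha
    obtain ⟨ε, hε, hεa⟩ : ∃ ε : ℝ, 0 < ε ∧ lam * (h + 2 * ε) < a := by
      refine ⟨(a - lam * h) / (4 * lam), div_pos (by linarith) (by positivity), ?_⟩
      have : (a - lam * h) / (4 * lam) * (4 * lam) = a - lam * h :=
        div_mul_cancel₀ _ (by positivity)
      nlinarith
    obtain ⟨k1, k2⟩ := key (h / 2) hε
    have hb := (integral_trapezoid_mem (r := h / 2) (by linarith) hε).2
    have hlt : lam * ∫ u, trapezoid (h / 2) ε u < a :=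
      (mul_le_mul_of_nonneg_left (by linarith) hlam0.le).trans_lt hεa
    filter_upwards [(k2.comp hshift).eventually_lt_const hlt] with t ht
    refine lt_of_le_of_lt ?_ ht
    rw [← integral_indicator_one measurableSet_Ioc]
    refine integral_mono (hI t) (k1 _) fun s => ?_
    by_cases hs : s ∈ Ioc t (t + h)
    · rw [indicator_of_mem hs]
      refine (trapezoid_eq_one hε ?_).ge
      exact abs_le.2 ⟨by linarith [hs.2], by linarith [hs.1]⟩
    · rw [indicator_of_notMem hs]; exact trapezoid_nonneg _ _ _

/-- Tonelli on `t < s ≤ t + x < s + y`: for fixed `y`, the admissible `s` form a window of length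
`min x y` ending at `t + x`. -/
theorem setLIntegral_Ioc_tail (t : ℝ) {x : ℝ} :
    ∫⁻ s in Ioc t (t + x), ρ (Ioi (t + x - s)) ∂(renewalMeasure ρ)
      = ∫⁻ y, renewalMeasure ρ (Ioc (t + x - min x y) (t + x)) ∂ρ := by
  have hset : MeasurableSet {p : ℝ × ℝ | t < p.1 ∧ p.1 ≤ t + x ∧ t + x - p.1 < p.2} :=
    (measurableSet_lt measurable_const measurable_fst).inter
      ((measurableSet_le measurable_fst measurable_const).inter
        (measurableSet_lt (by fun_prop) measurable_snd))
  have h1 := Measure.prod_apply (μ := renewalMeasure ρ) (ν := ρ) hset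
  have h2 := Measure.prod_apply_symm (μ := renewalMeasure ρ) (ν := ρ) hset
  rw [← lintegral_indicator measurableSet_Ioc]
  convert h1.symm.trans h2 using 1
  · refine lintegral_congr fun s => ?_
    by_cases hs : s ∈ Ioc t (t + x)
    · rw [indicator_of_mem hs]
      congr 1
      ext y
      simp only [mem_Ioi, mem_preimage, mem_ofPred_eq]
      exact ⟨fun h => ⟨hs.1, hs.2, h⟩, fun h => h.2.2⟩
    · rw [indicator_of_notMem hs, eq_comm]
      convert measure_empty (μ := ρ)
      ext y
      simp only [mem_preimage, mem_ofPred_eq, mem_empty_iff_false, iff_false]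
      exact fun h => hs ⟨h.1, h.2.1⟩
  · refine lintegral_congr fun y => ?_
    congr 1
    ext s
    simp only [mem_Ioc, mem_preimage, mem_ofPred_eq]
    rcases le_total x y with h | h
    · rw [min_eq_left h]
      exact ⟨fun h => ⟨by linarith, h.2, by linarith⟩, fun h => ⟨by linarith, h.2.1⟩⟩
    · rw [min_eq_right h]
      exact ⟨fun h => ⟨by linarith, h.2, by linarith⟩, fun h => ⟨by linarith, h.2.1⟩⟩

/-- Blackwell applies to each window of length `min x y`, with domination by a uniform bound; the
layer-cake formula turns the limit `∫ min x y dρ` into the integrated tail. -/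
theorem tendsto_setLIntegral_Ioc_tail (hρ : ∀ᵐ x ∂ρ, 0 < x)
    (hna : ¬ ∃ δ : ℝ, 0 < δ ∧ ∀ᵐ x ∂ρ, ∃ n : ℕ, 1 ≤ n ∧ x = n * δ) (hint : Integrable id ρ)
    {x : ℝ} (hx : 0 ≤ x) :
    Tendsto (fun t => (∫⁻ s in Ioc t (t + x), ρ (Ioi (t + x - s)) ∂(renewalMeasure ρ)).toReal) atTop
      (𝓝 ((∫ y, y ∂ρ)⁻¹ * ∫ u in (0 : ℝ)..x, ρ.real (Ioi u))) := by
  have hlayer : ∫ y, min x y ∂ρ = ∫ u in (0 : ℝ)..x, ρ.real (Ioi u) := by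
    have h0 : 0 ≤ᵐ[ρ] fun y => min x y := hρ.mono fun y hy => le_min hx hy.le
    have hmi : Integrable (fun y => min x y) ρ := (integrable_const x).inf hint
    rw [hmi.integral_eq_integral_meas_lt h0,
      intervalIntegral.integral_of_le hx, integral_Ioc_eq_integral_Ioo,
      ← integral_indicator measurableSet_Ioi, ← integral_indicator measurableSet_Ioo]
    refine integral_congr_ae (Eventually.of_forall fun u => ?_)
    by_cases hu : u ∈ Ioo 0 x
    · rw [indicator_of_mem hu, indicator_of_mem (show u ∈ Ioi (0 : ℝ) from hu.1)]
      congr 1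
      ext y
      simp [hu.2]
    · rw [indicator_of_notMem hu]
      by_cases hu0 : u ∈ Ioi (0 : ℝ)
      · rw [indicator_of_mem hu0]
        have : {y | u < min x y} = ∅ := by
          ext y
          simp only [lt_min_iff, mem_ofPred_eq, mem_empty_iff_false, iff_false]
          exact fun h => hu ⟨hu0, h.1⟩
        rw [this, measureReal_empty]
      · rw [indicator_of_notMem hu0]
  simp only [setLIntegral_Ioc_tail]
  obtain ⟨C, hC⟩ := exists_renewalMeasure_Ioc_le hρ x
  have hle : ∀ t y, renewalMeasure ρ (Ioc (t + x - min x y) (t + x)) ≤ C := fun t y =>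
    (measure_mono (Ioc_subset_Ioc_left (by linarith [min_le_left x y]))).trans (hC t)
  have hmeas : ∀ t, Measurable fun y => renewalMeasure ρ (Ioc (t + x - min x y) (t + x)) := by
    intro t
    have : Monotone fun y => renewalMeasure ρ (Ioc (t + x - min x y) (t + x)) := fun a b hab =>
      measure_mono (Ioc_subset_Ioc_left (by linarith [min_le_min_left x hab]))
    exact this.measurable
  have hreal : ∀ t, (∫⁻ y, renewalMeasure ρ (Ioc (t + x - min x y) (t + x)) ∂ρ).toReal
      = ∫ y, (renewalMeasure ρ).real (Ioc (t + x - min x y) (t + x)) ∂ρ := fun t =>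
    (integral_toReal (hmeas t).aemeasurable (Eventually.of_forall fun y =>
      (hle t y).trans_lt ENNReal.coe_lt_top)).symm
  simp only [hreal]
  rw [← hlayer, ← integral_const_mul]
  refine tendsto_integral_filter_of_dominated_convergence (fun _ => (C : ℝ))
    (Eventually.of_forall fun t => (hmeas t).ennreal_toReal.aestronglyMeasurable)
    (Eventually.of_forall fun t => Eventually.of_forall fun y => by
      rw [Real.norm_eq_abs, abs_of_nonneg measureReal_nonneg]
      exact ENNReal.toReal_le_coe_of_le_coe (hle t y))
    (integrable_const _) ?_
  filter_upwards [hρ] with y hy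
  -- Blackwell needs a window of positive length; for `x = 0` it is empty.
  rcases hx.eq_or_lt with rfl | hx
  · simp [min_eq_left hy.le]
  have h1 := (tendsto_renewalMeasure_Ioc hρ hna hint (lt_min hx hy)).comp
    (tendsto_atTop_add_const_right (atTop : Filter ℝ) (x - min x y) tendsto_id)
  refine h1.congr fun t => ?_
  simp only [Function.comp, id]
  congr 2 <;> ring

end

/-! ### Pathwise description of the count and the residual -/

section Path

variable {Ω : Type*} {T : ℕ → Ω → ℝ} {ω : Ω}

theorem countingTime_succ (T : ℕ → Ω → ℝ) (n : ℕ) (ω : Ω) :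
    countingTime T (n + 1) ω = countingTime T n ω + T n ω :=
  Finset.sum_range_succ _ _

theorem strictMono_countingTime (hpos : ∀ n, 0 < T n ω) :
    StrictMono fun n => countingTime T n ω :=
  strictMono_nat_of_lt_succ fun n => by rw [countingTime_succ]; linarith [hpos n]

/-- The indices counted form an initial segment, finite by divergence, so `ncard` is its true size.
As index `0` is counted, `count` is the first index whose time exceeds `t`. -/
theorem countingTime_le_iff_lt_count (hpos : ∀ n, 0 < T n ω)
    (hlim : Tendsto (fun n => countingTime T n ω) atTop atTop) (t : ℝ) (n : ℕ) :
    countingTime T n ω ≤ t ↔ n < count T t ω := by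
  have hex : ∃ m, t < countingTime T m ω := (hlim.eventually_gt_atTop t).exists
  classical
  have hset : {n : ℕ | countingTime T n ω ≤ t} = Iio (Nat.find hex) := by
    ext k
    simp only [mem_ofPred_eq, mem_Iio]
    constructor
    · intro hk
      by_contra hcon
      have := (strictMono_countingTime hpos).monotone (not_lt.1 hcon)
      exact absurd (Nat.find_spec hex) (not_lt.2 (this.trans hk))
    · exact fun hk => not_lt.1 (Nat.find_min hex hk)
  have hcount : count T t ω = Nat.find hex := by
    rw [count, hset, ← Nat.card_coe_set_eq]; simp
  rw [hcount, ← mem_Iio, ← hset, mem_ofPred_eq]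

/-- The residual exceeds `x` when a single lifetime straddles all of `[t, t + x]`. The index `n` is
`count - 1`, legitimate because `t ≥ 0` makes the count positive. -/
theorem lt_residual_iff (hpos : ∀ n, 0 < T n ω)
    (hlim : Tendsto (fun n => countingTime T n ω) atTop atTop) {t x : ℝ} (ht : 0 ≤ t)
    (hx : 0 ≤ x) :
    x < residual T t ω ↔ ∃ n, countingTime T n ω ≤ t ∧ t + x < countingTime T (n + 1) ω := by
  have key := countingTime_le_iff_lt_count hpos hlim t
  constructor
  · intro h
    have h0 : 0 < count T t ω := (key 0).1 (by simpa [countingTime] using ht)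
    refine ⟨count T t ω - 1, (key _).2 (Nat.sub_lt h0 one_pos), ?_⟩
    rw [show count T t ω - 1 + 1 = count T t ω by omega]
    rw [residual] at h
    linarith
  · rintro ⟨n, h1, h2⟩
    have h3 : ¬ n + 1 < count T t ω := fun h => by linarith [(key _).2 h]
    have h4 : count T t ω = n + 1 := le_antisymm (not_lt.1 h3) ((key n).1 h1)
    rw [residual, h4]
    linarith

theorem residual_pos (hpos : ∀ n, 0 < T n ω)
    (hlim : Tendsto (fun n => countingTime T n ω) atTop atTop) (t : ℝ) :
    0 < residual T t ω := by
  have key := countingTime_le_iff_lt_count hpos hlim t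
  have : ¬ countingTime T (count T t ω) ω ≤ t := fun h => lt_irrefl _ ((key _).1 h)
  rw [residual]; linarith

theorem tsum_indicator_countingTime (hpos : ∀ n, 0 < T n ω)
    (hlim : Tendsto (fun n => countingTime T n ω) atTop atTop) (t : ℝ) :
    ∑' n, {ω | countingTime T n ω ≤ t}.indicator (1 : Ω → ℝ≥0∞) ω = count T t ω := by
  have key := countingTime_le_iff_lt_count hpos hlim t
  rw [tsum_eq_sum (s := Finset.range (count T t ω))]
  · rw [Finset.sum_congr rfl (g := fun _ => 1)]
    · simp
    · intro n hn
      have hmem : ω ∈ {ω | countingTime T n ω ≤ t} := (key n).2 (Finset.mem_range.1 hn)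
      rw [indicator_of_mem hmem, Pi.one_apply]
  · intro n hn
    have hmem : ω ∉ {ω | countingTime T n ω ≤ t} := fun h =>
      hn (Finset.mem_range.2 ((key n).1 h))
    exact indicator_of_notMem hmem _

end Path

/-! ### Transfer between the process and the renewal measure -/

section Counting

variable {Ω : Type*} [MeasurableSpace Ω] {μ : Measure Ω} {T : ℕ → Ω → ℝ}

theorem measurable_countingTime (hmeas : ∀ n, Measurable (T n)) (n : ℕ) :
    Measurable (countingTime T n) :=
  Finset.measurable_fun_sum _ fun i _ => hmeas i

theorem indepFun_countingTime (hmeas : ∀ n, Measurable (T n)) (hindep : iIndepFun T μ) (n : ℕ) :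
    IndepFun (countingTime T n) (T n) μ := by
  have := hindep.indepFun_finsetSum_of_notMem hmeas (s := Finset.range n) (i := n) (by simp)
  convert this using 1
  ext ω
  simp [countingTime]

theorem ae_map_pos (hmeas : ∀ n, Measurable (T n)) (hpos : ∀ᵐ ω ∂μ, 0 < T 0 ω) :
    ∀ᵐ x ∂(μ.map (T 0)), 0 < x :=
  (ae_map_iff (hmeas 0).aemeasurable measurableSet_Ioi).2 hpos

variable [IsProbabilityMeasure μ]

theorem map_countingTime (hmeas : ∀ n, Measurable (T n)) (hindep : iIndepFun T μ)
    (hident : ∀ n, IdentDistrib (T n) (T 0) μ μ) (n : ℕ) :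
    μ.map (countingTime T n) = convPow (μ.map (T 0)) n := by
  induction n with
  | zero =>
    have : countingTime T 0 = fun _ => 0 := by ext; simp [countingTime]
    rw [this, Measure.map_const]; simp [convPow]
  | succ n ih =>
    have : countingTime T (n + 1) = countingTime T n + T n := by
      ext ω; exact countingTime_succ T n ω
    rw [this, (indepFun_countingTime hmeas hindep n).map_add_eq_map_conv_map
      (measurable_countingTime hmeas n) (hmeas n), ih, (hident n).map_eq, convPow]

theorem tsum_measure_countingTime_le (hmeas : ∀ n, Measurable (T n)) (hindep : iIndepFun T μ)
    (hident : ∀ n, IdentDistrib (T n) (T 0) μ μ) (t : ℝ) :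
    ∑' n, μ {ω | countingTime T n ω ≤ t} = renewalMeasure (μ.map (T 0)) (Iic t) := by
  rw [renewalMeasure, Measure.sum_apply _ measurableSet_Iic]
  refine tsum_congr fun n => ?_
  rw [← map_countingTime hmeas hindep hident,
    Measure.map_apply (measurable_countingTime hmeas n) measurableSet_Iic]
  rfl

/-- Divergence comes from Borel–Cantelli: the expected number of renewals up to each integer is
finite. -/
theorem ae_pos_and_tendsto (hmeas : ∀ n, Measurable (T n)) (hindep : iIndepFun T μ)
    (hident : ∀ n, IdentDistrib (T n) (T 0) μ μ) (hpos : ∀ᵐ ω ∂μ, 0 < T 0 ω) :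
    ∀ᵐ ω ∂μ, (∀ n, 0 < T n ω) ∧ Tendsto (fun n => countingTime T n ω) atTop atTop := by
  have : IsProbabilityMeasure (μ.map (T 0)) :=
    Measure.isProbabilityMeasure_map (hmeas 0).aemeasurable
  have h1 : ∀ᵐ ω ∂μ, ∀ n, 0 < T n ω := ae_all_iff.2 fun n =>
    (hident n).symm.ae_snd measurableSet_Ioi hpos
  have h2 : ∀ᵐ ω ∂μ, ∀ k : ℕ, ∀ᶠ n in atTop, ω ∉ {ω | countingTime T n ω ≤ k} :=
    ae_all_iff.2 fun k => ae_eventually_notMem (by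
      rw [tsum_measure_countingTime_le hmeas hindep hident]
      exact (renewalMeasure_Iic_lt_top (ae_map_pos hmeas hpos) _).ne)
  filter_upwards [h1, h2] with ω hω1 hω2
  refine ⟨hω1, tendsto_atTop.2 fun b => ?_⟩
  obtain ⟨k, hk⟩ := exists_nat_ge b
  filter_upwards [hω2 k] with n hn
  exact hk.trans (not_le.1 hn).le

theorem aemeasurable_count (hmeas : ∀ n, Measurable (T n)) (hindep : iIndepFun T μ)
    (hident : ∀ n, IdentDistrib (T n) (T 0) μ μ) (hpos : ∀ᵐ ω ∂μ, 0 < T 0 ω) (t : ℝ) :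
    AEMeasurable (count T t) μ := by
  refine ⟨fun ω => ⌊(∑' n, {ω | countingTime T n ω ≤ t}.indicator (1 : Ω → ℝ≥0∞) ω).toReal⌋₊,
    ?_, ?_⟩
  · refine Nat.measurable_floor.comp (Measurable.ennreal_toReal (Measurable.tsum fun n => ?_))
    exact measurable_one.indicator (measurable_countingTime hmeas n measurableSet_Iic)
  · filter_upwards [ae_pos_and_tendsto hmeas hindep hident hpos] with ω hω
    rw [tsum_indicator_countingTime hω.1 hω.2]
    simp

theorem aemeasurable_residual (hmeas : ∀ n, Measurable (T n)) (hindep : iIndepFun T μ)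
    (hident : ∀ n, IdentDistrib (T n) (T 0) μ μ) (hpos : ∀ᵐ ω ∂μ, 0 < T 0 ω) (t : ℝ) :
    AEMeasurable (residual T t) μ := by
  have h1 : Measurable fun p : ℕ × Ω => countingTime T p.1 p.2 :=
    measurable_from_prod_countable_right fun n => measurable_countingTime hmeas n
  exact (h1.comp_aemeasurable
    ((aemeasurable_count hmeas hindep hident hpos t).prodMk aemeasurable_id)).sub_const t

theorem lintegral_count (hmeas : ∀ n, Measurable (T n)) (hindep : iIndepFun T μ)
    (hident : ∀ n, IdentDistrib (T n) (T 0) μ μ) (hpos : ∀ᵐ ω ∂μ, 0 < T 0 ω) (t : ℝ) :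
    ∫⁻ ω, (count T t ω : ℝ≥0∞) ∂μ = renewalMeasure (μ.map (T 0)) (Iic t) := by
  have hm : ∀ n, MeasurableSet {ω | countingTime T n ω ≤ t} := fun n =>
    measurable_countingTime hmeas n measurableSet_Iic
  rw [← tsum_measure_countingTime_le hmeas hindep hident]
  calc ∫⁻ ω, (count T t ω : ℝ≥0∞) ∂μ
      = ∫⁻ ω, ∑' n, {ω | countingTime T n ω ≤ t}.indicator (1 : Ω → ℝ≥0∞) ω ∂μ := by
        refine lintegral_congr_ae ?_
        filter_upwards [ae_pos_and_tendsto hmeas hindep hident hpos] with ω hω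
        rw [tsum_indicator_countingTime hω.1 hω.2]
    _ = ∑' n, μ {ω | countingTime T n ω ≤ t} := by
        rw [lintegral_tsum fun n => (measurable_one.indicator (hm n)).aemeasurable]
        exact tsum_congr fun n => lintegral_indicator_one (hm n)

theorem integrable_count (hmeas : ∀ n, Measurable (T n)) (hindep : iIndepFun T μ)
    (hident : ∀ n, IdentDistrib (T n) (T 0) μ μ) (hpos : ∀ᵐ ω ∂μ, 0 < T 0 ω) (t : ℝ) :
    Integrable (fun ω => (count T t ω : ℝ)) μ := by
  have : IsProbabilityMeasure (μ.map (T 0)) :=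
    Measure.isProbabilityMeasure_map (hmeas 0).aemeasurable
  have hm : AEMeasurable (fun ω => (count T t ω : ℝ≥0∞)) μ :=
    (measurable_of_countable _).comp_aemeasurable (aemeasurable_count hmeas hindep hident hpos t)
  have := integrable_toReal_of_lintegral_ne_top hm (by
    rw [lintegral_count hmeas hindep hident hpos]
    exact (renewalMeasure_Iic_lt_top (ae_map_pos hmeas hpos) _).ne)
  simpa using this

theorem integral_count_sub (hmeas : ∀ n, Measurable (T n)) (hindep : iIndepFun T μ)
    (hident : ∀ n, IdentDistrib (T n) (T 0) μ μ) (hpos : ∀ᵐ ω ∂μ, 0 < T 0 ω) (t : ℝ)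
    {h : ℝ} (hh : 0 ≤ h) :
    ∫ ω, ((count T (t + h) ω : ℝ) - (count T t ω : ℝ)) ∂μ
      = (renewalMeasure (μ.map (T 0))).real (Ioc t (t + h)) := by
  have : IsProbabilityMeasure (μ.map (T 0)) :=
    Measure.isProbabilityMeasure_map (hmeas 0).aemeasurable
  have hfin := fun t => (renewalMeasure_Iic_lt_top (ae_map_pos hmeas hpos) t).ne
  have hI : ∀ t, ∫ ω, (count T t ω : ℝ) ∂μ = (renewalMeasure (μ.map (T 0))).real (Iic t) := by
    intro t
    have hm : AEMeasurable (fun ω => (count T t ω : ℝ≥0∞)) μ :=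
      (measurable_of_countable _).comp_aemeasurable (aemeasurable_count hmeas hindep hident hpos t)
    have := integral_toReal hm (Eventually.of_forall fun ω => by simp)
    simp only [ENNReal.toReal_natCast] at this
    rw [this, lintegral_count hmeas hindep hident hpos, measureReal_def]
  rw [integral_sub (integrable_count hmeas hindep hident hpos _)
    (integrable_count hmeas hindep hident hpos _), hI, hI, ← Iic_union_Ioc_eq_Iic
    (show t ≤ t + h by linarith), measureReal_union ((Iic_disjoint_Ioc le_rfl))
    measurableSet_Ioc (hfin t)
    (ne_top_of_le_ne_top (hfin (t + h)) (measure_mono Ioc_subset_Iic_self))]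
  ring

/-- Decompose by the index of the straddling lifetime; these events are almost surely disjoint, and
that lifetime is independent of the time at which it starts. -/
theorem measure_lt_residual (hmeas : ∀ n, Measurable (T n)) (hindep : iIndepFun T μ)
    (hident : ∀ n, IdentDistrib (T n) (T 0) μ μ) (hpos : ∀ᵐ ω ∂μ, 0 < T 0 ω) {t x : ℝ}
    (ht : 0 ≤ t) (hx : 0 ≤ x) :
    μ {ω | x < residual T t ω}
      = ∫⁻ s in Iic t, μ.map (T 0) (Ioi (t + x - s)) ∂(renewalMeasure (μ.map (T 0))) := by
  have : IsProbabilityMeasure (μ.map (T 0)) :=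
    Measure.isProbabilityMeasure_map (hmeas 0).aemeasurable
  set A : ℕ → Set Ω := fun n => {ω | countingTime T n ω ≤ t ∧ t + x < countingTime T (n + 1) ω}
  have hA : ∀ n, MeasurableSet (A n) := fun n =>
    (measurableSet_le (measurable_countingTime hmeas n) measurable_const).inter
      (measurableSet_lt measurable_const (measurable_countingTime hmeas (n + 1)))
  have hgood := ae_pos_and_tendsto hmeas hindep hident hpos
  have h1 : μ {ω | x < residual T t ω} = μ (⋃ n, A n) := by
    refine measure_congr (eventuallyEq_set.2 ?_)
    filter_upwards [hgood] with ω hω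
    exact (lt_residual_iff hω.1 hω.2 ht hx).trans (mem_iUnion (s := A)).symm
  have hdisj : Pairwise (Function.onFun (AEDisjoint μ) A) := by
    have key : ∀ n m, n < m → AEDisjoint μ (A n) (A m) := by
      intro n m hnm
      refine measure_mono_null (t := {ω | ¬ ((∀ n, 0 < T n ω) ∧
        Tendsto (fun n => countingTime T n ω) atTop atTop)}) ?_ hgood
      rintro ω ⟨⟨_, h2⟩, h3, _⟩ hω
      have := (strictMono_countingTime hω.1).monotone (Nat.succ_le_of_lt hnm)
      simp only [Nat.succ_eq_add_one] at this
      linarith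
    intro n m hnm
    rcases hnm.lt_or_gt with h | h
    · exact key n m h
    · exact (key m n h).symm
  rw [h1, measure_iUnion₀ hdisj fun n => (hA n).nullMeasurableSet,
    ← lintegral_indicator measurableSet_Iic, renewalMeasure, lintegral_sum_measure]
  refine tsum_congr fun n => ?_
  have hB : MeasurableSet {p : ℝ × ℝ | p.1 ≤ t ∧ t + x < p.1 + p.2} :=
    (measurableSet_le measurable_fst measurable_const).inter
      (measurableSet_lt measurable_const (measurable_fst.add measurable_snd))
  have h2 := (indepFun_iff_map_prod_eq_prod_map_map (measurable_countingTime hmeas n).aemeasurable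
    (hmeas n).aemeasurable).1 (indepFun_countingTime hmeas hindep n)
  have h3 : μ (A n) = μ.map (fun ω => (countingTime T n ω, T n ω))
      {p : ℝ × ℝ | p.1 ≤ t ∧ t + x < p.1 + p.2} := by
    rw [Measure.map_apply ((measurable_countingTime hmeas n).prodMk (hmeas n)) hB]
    congr 1
    ext ω
    simp only [A, mem_preimage, mem_ofPred_eq, countingTime_succ]
  rw [h3, h2, map_countingTime hmeas hindep hident, (hident n).map_eq, Measure.prod_apply hB]
  refine lintegral_congr fun s => ?_
  by_cases hs : s ∈ Iic t
  · rw [indicator_of_mem hs]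
    congr 1
    ext y
    simp only [mem_preimage, mem_ofPred_eq, mem_Ioi]
    exact ⟨fun h => by linarith [h.2], fun h => ⟨hs, by linarith⟩⟩
  · rw [indicator_of_notMem hs]
    convert measure_empty (μ := μ.map (T 0))
    ext y
    simp only [mem_preimage, mem_ofPred_eq, mem_empty_iff_false, iff_false]
    exact fun h => hs h.1

/-- Take the complement in the covering identity at `t + x`: the interval covering `t + x` starts
either by time `t`, which means `R(t) > x`, or in `(t, t + x]`. -/
theorem measure_residual_le (hmeas : ∀ n, Measurable (T n)) (hindep : iIndepFun T μ)
    (hident : ∀ n, IdentDistrib (T n) (T 0) μ μ) (hpos : ∀ᵐ ω ∂μ, 0 < T 0 ω) {t x : ℝ}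
    (ht : 0 ≤ t) (hx : 0 ≤ x) :
    μ {ω | residual T t ω ≤ x} = ∫⁻ s in Ioc t (t + x), μ.map (T 0) (Ioi (t + x - s))
      ∂(renewalMeasure (μ.map (T 0))) := by
  have : IsProbabilityMeasure (μ.map (T 0)) :=
    Measure.isProbabilityMeasure_map (hmeas 0).aemeasurable
  have h1 := setLIntegral_Iic_tail (ae_map_pos hmeas hpos) (t + x)
  rw [indicator_of_mem (show t + x ∈ Ici (0 : ℝ) from add_nonneg ht hx), Pi.one_apply,
    ← Iic_union_Ioc_eq_Iic (show t ≤ t + x by linarith),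
    lintegral_union measurableSet_Ioc (Iic_disjoint_Ioc le_rfl),
    ← measure_lt_residual hmeas hindep hident hpos ht hx] at h1
  have h2 : NullMeasurableSet {ω | x < residual T t ω} μ :=
    nullMeasurableSet_lt aemeasurable_const (aemeasurable_residual hmeas hindep hident hpos t)
  have h3 := measure_add_measure_compl₀ h2
  have h4 : {ω | x < residual T t ω}ᶜ = {ω | residual T t ω ≤ x} := by
    ext ω; simp
  rw [h4, measure_univ, ← h1] at h3
  exact (ENNReal.add_right_inj (measure_ne_top _ _)).1 h3

end Counting

/-! ### The equilibrium law and weak convergence -/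

/-- The equilibrium law, with density `ρ (u, ∞) / ∫ x dρ` on `u ≥ 0`. -/
noncomputable def equilibriumLaw (ρ : Measure ℝ) : Measure ℝ :=
  ENNReal.ofReal (∫ x, x ∂ρ)⁻¹ • volume.withDensity (tail ρ)

theorem isProbabilityMeasure_equilibriumLaw {ρ : Measure ℝ} [IsProbabilityMeasure ρ]
    (hρ : ∀ᵐ x ∂ρ, 0 < x) (hint : Integrable id ρ) :
    IsProbabilityMeasure (equilibriumLaw ρ) := by
  refine ⟨?_⟩
  have hm := mean_pos hρ hint
  rw [equilibriumLaw, Measure.smul_apply, withDensity_apply _ MeasurableSet.univ,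
    Measure.restrict_univ, lintegral_tail hρ hint, smul_eq_mul,
    ← ENNReal.ofReal_mul (inv_pos.2 hm).le, inv_mul_cancel₀ hm.ne', ENNReal.ofReal_one]

theorem equilibriumLaw_real_Iic_of_neg (ρ : Measure ℝ) {x : ℝ} (hx : x < 0) :
    (equilibriumLaw ρ).real (Iic x) = 0 := by
  have : ∫⁻ u in Iic x, tail ρ u = 0 := by
    rw [setLIntegral_congr_fun (g := fun _ => 0) measurableSet_Iic, lintegral_zero]
    intro u hu
    refine indicator_of_notMem (fun h => ?_) _
    rw [mem_Ici] at h; rw [mem_Iic] at hu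
    linarith
  rw [measureReal_def, equilibriumLaw, Measure.smul_apply, withDensity_apply _ measurableSet_Iic,
    this]
  simp

theorem equilibriumLaw_real_Iic {ρ : Measure ℝ} [IsProbabilityMeasure ρ]
    (hρ : ∀ᵐ x ∂ρ, 0 < x) (hint : Integrable id ρ) {x : ℝ} (hx : 0 ≤ x) :
    (equilibriumLaw ρ).real (Iic x) = (∫ y, y ∂ρ)⁻¹ * ∫ u in (0 : ℝ)..x, ρ.real (Ioi u) := by
  have hm := mean_pos hρ hint
  rw [measureReal_def, equilibriumLaw, Measure.smul_apply, withDensity_apply _ measurableSet_Iic,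
    smul_eq_mul, ENNReal.toReal_mul, ENNReal.toReal_ofReal (inv_pos.2 hm).le,
    ← integral_toReal (measurable_tail ρ).aemeasurable
      (Eventually.of_forall fun u => (tail_ne_top u).lt_top),
    intervalIntegral.integral_of_le hx, ← integral_Icc_eq_integral_Ioc]
  congr 1
  rw [← integral_indicator measurableSet_Iic, ← integral_indicator measurableSet_Icc]
  refine integral_congr_ae (Eventually.of_forall fun u => ?_)
  simp only [indicator, tail, mem_Iic, mem_Icc, mem_Ici, measureReal_def]
  by_cases h1 : 0 ≤ u <;> by_cases h2 : u ≤ x <;> simp [h1, h2]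

/-- Pointwise convergence of distribution functions implies weak convergence. -/
theorem tendsto_of_tendsto_real_Iic {ι : Type*} {l : Filter ι} [l.IsCountablyGenerated]
    {P : ι → ProbabilityMeasure ℝ} {Q : ProbabilityMeasure ℝ}
    (h : ∀ x, Tendsto (fun i => (P i : Measure ℝ).real (Iic x)) l
      (𝓝 ((Q : Measure ℝ).real (Iic x)))) :
    Tendsto P l (𝓝 Q) := by
  refine (isPiSystem_Ioc (id : ℝ → ℝ) id).tendsto_probabilityMeasure_of_tendsto_of_mem ?_ ?_ ?_
  · rintro s ⟨a, b, -, rfl⟩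
    exact measurableSet_Ioc
  · intro u hu x hx
    obtain ⟨a, b, hab, hsub⟩ := mem_nhds_iff_exists_Ioo_subset.1 (hu.mem_nhds hx)
    -- Stopping at the midpoint keeps the closed right end inside the open interval.
    refine ⟨Ioc a ((x + b) / 2), ⟨a, (x + b) / 2, ?_, rfl⟩, Ioc_mem_nhds hab.1 ?_, fun y hy =>
      hsub ⟨hy.1, ?_⟩⟩
    · simp only [id]; linarith [hab.1, hab.2]
    · linarith [hab.2]
    · linarith [hab.2, hy.2]
  · rintro s ⟨a, b, hab, rfl⟩
    simp only [id] at hab ⊢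
    have key : ∀ R : ProbabilityMeasure ℝ, ((R (Ioc a b) : ℝ≥0) : ℝ)
        = (R : Measure ℝ).real (Iic b) - (R : Measure ℝ).real (Iic a) := by
      intro R
      have h1 : (R : Measure ℝ).real (Iic b)
          = (R : Measure ℝ).real (Iic a) + (R : Measure ℝ).real (Ioc a b) := by
        rw [← Iic_union_Ioc_eq_Iic hab.le,
          measureReal_union (Iic_disjoint_Ioc le_rfl) measurableSet_Ioc]
      rw [h1, add_sub_cancel_left]
      rfl
    rw [← NNReal.tendsto_coe]
    simp only [key]
    exact (h b).sub (h a)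

/-! ### The implications between the three conditions -/

section Main

variable {Ω : Type*} [MeasurableSpace Ω] {μ : Measure Ω} {T : ℕ → Ω → ℝ}

theorem rate_eq (hmeas : ∀ n, Measurable (T n)) : rate T μ = (∫ x, x ∂(μ.map (T 0)))⁻¹ := by
  rw [rate, one_div, integral_map (f := fun x : ℝ => x) (hmeas 0).aemeasurable
    measurable_id.aestronglyMeasurable]

theorem limitCdf_eq (hmeas : ∀ n, Measurable (T n)) (x : ℝ) :
    limitCdf T μ x
      = (∫ y, y ∂(μ.map (T 0)))⁻¹ * ∫ u in (0 : ℝ)..x, (μ.map (T 0)).real (Ioi u) := by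
  rw [limitCdf, rate_eq hmeas]
  simp only [map_measureReal_apply (hmeas 0) measurableSet_Ioi]
  rfl

theorem integrable_id_map (hmeas : ∀ n, Measurable (T n)) (hint : Integrable (T 0) μ) :
    Integrable id (μ.map (T 0)) :=
  (integrable_map_measure measurable_id.aestronglyMeasurable (hmeas 0).aemeasurable).2 hint

variable [IsProbabilityMeasure μ]

theorem nonArithmetic_iff_map {X : Ω → ℝ} (hX : Measurable X) :
    NonArithmetic X μ ↔
      ¬ ∃ δ : ℝ, 0 < δ ∧ ∀ᵐ x ∂(μ.map X), ∃ n : ℕ, 1 ≤ n ∧ x = n * δ := by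
  refine not_congr (exists_congr fun δ => and_congr_right fun _ => ?_)
  have hset : MeasurableSet {x : ℝ | ∃ n : ℕ, 1 ≤ n ∧ x = n * δ} := by
    refine ((countable_range fun n : ℕ => (n : ℝ) * δ).mono ?_).measurableSet
    rintro x ⟨n, -, rfl⟩
    exact ⟨n, rfl⟩
  rw [ae_map_iff hX.aemeasurable hset]
  exact (mem_ae_iff_prob_eq_one (hX hset)).symm

theorem NonArithmetic.blackwell (hna : NonArithmetic (T 0) μ) (hmeas : ∀ n, Measurable (T n))
    (hindep : iIndepFun T μ) (hident : ∀ n, IdentDistrib (T n) (T 0) μ μ)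
    (hint : Integrable (T 0) μ) (hpos : ∀ᵐ ω ∂μ, 0 < T 0 ω) : Blackwell T μ := by
  have : IsProbabilityMeasure (μ.map (T 0)) :=
    Measure.isProbabilityMeasure_map (hmeas 0).aemeasurable
  refine fun h hh => ⟨fun t _ => (integrable_count hmeas hindep hident hpos _).sub
    (integrable_count hmeas hindep hident hpos _), ?_⟩
  simp only [integral_count_sub hmeas hindep hident hpos _ hh.le]
  rw [rate_eq hmeas]
  exact tendsto_renewalMeasure_Ioc (ae_map_pos hmeas hpos)
    ((nonArithmetic_iff_map (hmeas 0)).1 hna) (integrable_id_map hmeas hint) hh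

theorem NonArithmetic.tendsto_residual_le (hna : NonArithmetic (T 0) μ)
    (hmeas : ∀ n, Measurable (T n)) (hindep : iIndepFun T μ)
    (hident : ∀ n, IdentDistrib (T n) (T 0) μ μ) (hint : Integrable (T 0) μ)
    (hpos : ∀ᵐ ω ∂μ, 0 < T 0 ω) {x : ℝ} (hx : 0 ≤ x) :
    Tendsto (fun t : ℝ => μ.real {ω | residual T t ω ≤ x}) atTop (𝓝 (limitCdf T μ x)) := by
  have : IsProbabilityMeasure (μ.map (T 0)) :=
    Measure.isProbabilityMeasure_map (hmeas 0).aemeasurable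
  rw [limitCdf_eq hmeas]
  refine (tendsto_setLIntegral_Ioc_tail (ae_map_pos hmeas hpos)
    ((nonArithmetic_iff_map (hmeas 0)).1 hna) (integrable_id_map hmeas hint) hx).congr' ?_
  filter_upwards [eventually_ge_atTop 0] with t ht
  rw [measureReal_def, measure_residual_le hmeas hindep hident hpos ht hx]

theorem NonArithmetic.residualTendsto (hna : NonArithmetic (T 0) μ)
    (hmeas : ∀ n, Measurable (T n)) (hindep : iIndepFun T μ)
    (hident : ∀ n, IdentDistrib (T n) (T 0) μ μ) (hint : Integrable (T 0) μ)
    (hpos : ∀ᵐ ω ∂μ, 0 < T 0 ω) [IsProbabilityMeasure (equilibriumLaw (μ.map (T 0)))] :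
    ResidualTendsto T μ (equilibriumLaw (μ.map (T 0))) := by
  have : IsProbabilityMeasure (μ.map (T 0)) :=
    Measure.isProbabilityMeasure_map (hmeas 0).aemeasurable
  have hR := aemeasurable_residual hmeas hindep hident hpos
  refine ⟨hR, aemeasurable_id, tendsto_of_tendsto_real_Iic fun x => ?_⟩
  simp only [ProbabilityMeasure.coe_mk, Measure.map_id]
  have h1 : ∀ t, (μ.map (residual T t)).real (Iic x) = μ.real {ω | residual T t ω ≤ x} := by
    intro t
    rw [measureReal_def, Measure.map_apply_of_aemeasurable (hR t) measurableSet_Iic]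
    rfl
  simp only [h1]
  rcases lt_or_ge x 0 with hx | hx
  · rw [equilibriumLaw_real_Iic_of_neg _ hx]
    refine tendsto_const_nhds.congr fun t => ?_
    rw [measureReal_def, eq_comm, measure_mono_null (t := {ω | ¬ ((∀ n, 0 < T n ω) ∧
        Tendsto (fun n => countingTime T n ω) atTop atTop)}) ?_
        (ae_pos_and_tendsto hmeas hindep hident hpos), ENNReal.toReal_zero]
    intro ω hω hgood
    have := residual_pos hgood.1 hgood.2 t
    rw [mem_ofPred_eq] at hω
    linarith
  · rw [equilibriumLaw_real_Iic (ae_map_pos hmeas hpos) (integrable_id_map hmeas hint) hx,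
      ← limitCdf_eq hmeas]
    exact hna.tendsto_residual_le hmeas hindep hident hint hpos hx

theorem ae_countingTime_mem_multiples (hident : ∀ n, IdentDistrib (T n) (T 0) μ μ)
    (hmeas : ∀ n, Measurable (T n)) {δ : ℝ}
    (hδ : μ {ω | ∃ n : ℕ, 1 ≤ n ∧ T 0 ω = n * δ} = 1) :
    ∀ᵐ ω ∂μ, ∀ n, ∃ k : ℕ, countingTime T n ω = k * δ := by
  have hset : MeasurableSet {x : ℝ | ∃ n : ℕ, 1 ≤ n ∧ x = n * δ} := by
    refine ((countable_range fun n : ℕ => (n : ℝ) * δ).mono ?_).measurableSet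
    rintro x ⟨n, -, rfl⟩
    exact ⟨n, rfl⟩
  have h0 : ∀ᵐ ω ∂μ, ∃ n : ℕ, 1 ≤ n ∧ T 0 ω = n * δ :=
    (mem_ae_iff_prob_eq_one ((hmeas 0) hset)).2 hδ
  have h1 : ∀ᵐ ω ∂μ, ∀ n, ∃ k : ℕ, 1 ≤ k ∧ T n ω = k * δ := ae_all_iff.2 fun n =>
    (hident n).symm.ae_snd hset h0
  filter_upwards [h1] with ω hω n
  induction n with
  | zero => exact ⟨0, by simp [countingTime]⟩
  | succ n ih =>
    obtain ⟨k, hk⟩ := ih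
    obtain ⟨m, -, hm⟩ := hω n
    exact ⟨k + m, by rw [countingTime_succ, hk, hm]; push_cast; ring⟩

theorem tendsto_natCast_mul_atTop {δ : ℝ} (hδ : 0 < δ) :
    Tendsto (fun k : ℕ => (k : ℝ) * δ) atTop atTop :=
  tendsto_natCast_atTop_atTop.atTop_mul_const hδ

/-- With renewals on `δℕ`, the windows `(kδ, kδ + δ/2]` contain none, so the increments along `t =
kδ` are `0` rather than near `λ δ / 2 > 0`. -/
theorem Blackwell.nonArithmetic (hB : Blackwell T μ) (hmeas : ∀ n, Measurable (T n))
    (hident : ∀ n, IdentDistrib (T n) (T 0) μ μ) (hrate : 0 < rate T μ) :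
    NonArithmetic (T 0) μ := by
  rintro ⟨δ, hδ, harith⟩
  have h1 := ((hB (δ / 2) (half_pos hδ)).2).comp (tendsto_natCast_mul_atTop hδ)
  have h2 : ∀ k : ℕ, ∫ ω, ((count T (k * δ + δ / 2) ω : ℝ) - (count T (k * δ) ω : ℝ)) ∂μ = 0 := by
    intro k
    rw [← integral_zero Ω ℝ (μ := μ)]
    refine integral_congr_ae ?_
    filter_upwards [ae_countingTime_mem_multiples hident hmeas harith] with ω hω
    have hset : {n : ℕ | countingTime T n ω ≤ k * δ + δ / 2}
        = {n : ℕ | countingTime T n ω ≤ k * δ} := by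
      ext n
      obtain ⟨m, hm⟩ := hω n
      simp only [mem_ofPred_eq, hm]
      constructor
      · intro h
        have h3 : (m : ℝ) < k + 1 := by
          by_contra hcon
          have := mul_le_mul_of_nonneg_right (not_lt.1 hcon) hδ.le
          linarith
        have h4 : m ≤ k := Nat.lt_succ_iff.1 (by exact_mod_cast h3)
        exact mul_le_mul_of_nonneg_right (by exact_mod_cast h4) hδ.le
      · intro h; linarith
    rw [count, count, hset, sub_self]
  have h3 : Tendsto (fun _ : ℕ => (0 : ℝ)) atTop (𝓝 (rate T μ * (δ / 2))) :=
    h1.congr h2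
  have h4 := tendsto_nhds_unique h3 tendsto_const_nhds
  have : 0 < rate T μ * (δ / 2) := by positivity
  linarith

/-- The bounded test function `cos (2π x / δ)` detects the phase: in the arithmetic case its mean at
`R(t)` is `1` along `t = kδ` and `-1` along `t = kδ + δ/2`, so it has no limit. -/
theorem HasLimitLaw.nonArithmetic (hL : HasLimitLaw T μ) (hmeas : ∀ n, Measurable (T n))
    (hident : ∀ n, IdentDistrib (T n) (T 0) μ μ) : NonArithmetic (T 0) μ := by
  rintro ⟨δ, hδ, harith⟩
  obtain ⟨ν, hν, hR⟩ := hL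
  let f : BoundedContinuousFunction ℝ ℝ := BoundedContinuousFunction.ofNormedAddCommGroup
    (fun x => Real.cos (x * (2 * Real.pi / δ))) (by fun_prop) 1 fun x => Real.abs_cos_le_one _
  have hf : Tendsto (fun t : ℝ => ∫ ω, Real.cos (residual T t ω * (2 * Real.pi / δ)) ∂μ) atTop
      (𝓝 (∫ x, f x ∂(ν.map id))) := by
    refine (ProbabilityMeasure.tendsto_iff_forall_integral_tendsto.1 hR.tendsto f).congr fun t => ?_
    exact integral_map (hR.forall_aemeasurable t) f.continuous.aestronglyMeasurable
  have key : ∀ (k : ℕ) (a c : ℝ), (∀ m : ℤ, Real.cos (m * (2 * Real.pi) - a * (2 * Real.pi)) = c) →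
      ∫ ω, Real.cos (residual T (k * δ + a * δ) ω * (2 * Real.pi / δ)) ∂μ = c := by
    intro k a c hc
    have : ∫ _, c ∂μ = c := by simp
    rw [← this]
    refine integral_congr_ae ?_
    filter_upwards [ae_countingTime_mem_multiples hident hmeas harith] with ω hω
    obtain ⟨m, hm⟩ := hω (count T (k * δ + a * δ) ω)
    rw [residual, hm, ← hc (m - k)]
    congr 1
    push_cast
    field_simp
    ring
  have h1 : Tendsto (fun k : ℕ => (k : ℝ) * δ + 0 * δ) atTop atTop :=
    tendsto_atTop_add_const_right _ _ (tendsto_natCast_mul_atTop hδ)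
  have h2 : Tendsto (fun k : ℕ => (k : ℝ) * δ + 1 / 2 * δ) atTop atTop :=
    tendsto_atTop_add_const_right _ _ (tendsto_natCast_mul_atTop hδ)
  have e1 : Tendsto (fun _ : ℕ => (1 : ℝ)) atTop (𝓝 (∫ x, f x ∂(ν.map id))) :=
    (hf.comp h1).congr fun k => key k 0 1 fun m => by
      rw [zero_mul, sub_zero, Real.cos_int_mul_two_pi]
  have e2 : Tendsto (fun _ : ℕ => (-1 : ℝ)) atTop (𝓝 (∫ x, f x ∂(ν.map id))) :=
    (hf.comp h2).congr fun k => key k (1 / 2) (-1) fun m => by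
      rw [show (m : ℝ) * (2 * Real.pi) - 1 / 2 * (2 * Real.pi) = m * (2 * Real.pi) - Real.pi by ring,
        Real.cos_int_mul_two_pi_sub_pi]
  have := (tendsto_nhds_unique e1 tendsto_const_nhds).symm.trans
    (tendsto_nhds_unique e2 tendsto_const_nhds)
  norm_num at this

end Main

end Renewal

theorem lemma3p1 {Ω : Type*} [MeasurableSpace Ω] (μ : Measure Ω) [IsProbabilityMeasure μ]
    (T : ℕ → Ω → ℝ)
    (hmeas : ∀ n, Measurable (T n))
    (hindep : iIndepFun T μ)
    (hident : ∀ n, IdentDistrib (T n) (T 0) μ μ)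
    (hint : Integrable (T 0) μ)
    (hpos : ∀ᵐ ω ∂μ, 0 < T 0 ω) :
    [Renewal.NonArithmetic (T 0) μ, Renewal.Blackwell T μ, Renewal.HasLimitLaw T μ].TFAE ∧
    (Renewal.NonArithmetic (T 0) μ ∨ Renewal.Blackwell T μ ∨ Renewal.HasLimitLaw T μ →
      (∀ x : ℝ, 0 ≤ x →
        Tendsto (fun t : ℝ => μ.real {ω | Renewal.residual T t ω ≤ x}) atTop
          (𝓝 (Renewal.limitCdf T μ x))) ∧
      (∀ (ν : Measure ℝ) [IsProbabilityMeasure ν], Renewal.ResidualTendsto T μ ν →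
        ∀ x : ℝ, 0 ≤ x → ν.real (Set.Iic x) = Renewal.limitCdf T μ x)) := by
  have hρ : IsProbabilityMeasure (μ.map (T 0)) :=
    Measure.isProbabilityMeasure_map (hmeas 0).aemeasurable
  have hρpos := Renewal.ae_map_pos hmeas hpos
  have hρint := Renewal.integrable_id_map hmeas hint
  have hE := Renewal.isProbabilityMeasure_equilibriumLaw hρpos hρint
  have hrate : 0 < Renewal.rate T μ := by
    rw [Renewal.rate_eq hmeas]
    exact inv_pos.2 (Renewal.mean_pos hρpos hρint)
  have hab : Renewal.NonArithmetic (T 0) μ → Renewal.Blackwell T μ := fun h =>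
    h.blackwell hmeas hindep hident hint hpos
  have hba : Renewal.Blackwell T μ → Renewal.NonArithmetic (T 0) μ := fun h =>
    h.nonArithmetic hmeas hident hrate
  have hlim : Renewal.NonArithmetic (T 0) μ →
      Renewal.ResidualTendsto T μ (Renewal.equilibriumLaw (μ.map (T 0))) := fun h =>
    h.residualTendsto hmeas hindep hident hint hpos
  have hca : Renewal.HasLimitLaw T μ → Renewal.NonArithmetic (T 0) μ := fun h =>
    h.nonArithmetic hmeas hident
  refine ⟨?_, fun h => ?_⟩
  · tfae_have 1 → 2 := hab
    tfae_have 2 → 1 := hba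
    tfae_have 1 → 3 := fun h => ⟨_, hE, hlim h⟩
    tfae_have 3 → 1 := hca
    tfae_finish
  · have hna : Renewal.NonArithmetic (T 0) μ := h.elim id fun h => h.elim hba hca
    refine ⟨fun x hx => hna.tendsto_residual_le hmeas hindep hident hint hpos hx,
      fun ν hν hR x hx => ?_⟩
    -- Limits in distribution are unique, so any limit law is the equilibrium law, whose
    -- distribution function is known.
    have huniq := tendstoInDistribution_unique _ hR (hlim hna)
    rw [Measure.map_id, Measure.map_id] at huniq
    rw [huniq, Renewal.equilibriumLaw_real_Iic hρpos hρint hx, ← Renewal.limitCdf_eq hmeas]
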